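/- **Language.** Let $\mathcal A$ be a finite non-empty set of agents. Formulae are given by $\varphi ::= \bot \mid p \mid \varphi\wedge\varphi \mid \varphi\vee\varphi \mid \varphi\to\varphi \mid K_a\varphi \mid C\varphi$ ($p$ an atom, $a\in\mathcal A$), and $\neg\varphi := \varphi\to\bot$. A set of formulae is *closed* if (1) with $\varphi\ast\psi$, $\ast\in\{\wedge,\vee,\to\}$, it contains $\varphi$ and $\psi$; (2) with $K_a\varphi$ it contains $\varphi$; (3) with $C\varphi$ it contains $\varphi$ and all $K_aC\varphi$, $a\in\mathcal A$. It is *negation closed* if moreover with $K_a\varphi$ it contains $\neg K_a\varphi$. **Sequents.** An annotated formula is $\varphi^u$ ($\varphi$ unfocused) or $\varphi^f$ ($\varphi$ in focus). A *sequent* $\Gamma\Rightarrow\Delta$ is a pair of finite sets of annotated formulae such that all formulae of $\Gamma$ are unfocused, at most one formula of $\Delta$ is in focus, and any formula in focus has the form $C\psi$ or $K_aC\psi$. It is a *$\Sigma$-sequent* if all its formulae, without annotations, are in $\Sigma$. **Rules** (conclusion $\leftarrow$ premises; commas denote unions of sets, $x\in\{u,f\}$, $K_a\Gamma=\{(K_a\varphi)^x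 : \varphi^x\in\Gamma\}$; conclusion and premises must be sequents): - $\mathsf{id}$: $\Gamma,\varphi^u\Rightarrow\varphi^x,\Delta$, and $\bot$: $\Gamma,\bot^u\Rightarrow\Delta$, both without premises (axioms); - $\wedge\mathsf L$: $\Gamma,(\varphi\wedge\psi)^u\Rightarrow\Delta \leftarrow \Gamma,\varphi^u,\psi^u\Rightarrow\Delta$; $\wedge\mathsf R$: $\Gamma\Rightarrow(\varphi\wedge\psi)^u,\Delta \leftarrow \Gamma\Rightarrow\varphi^u,\Delta;\ \Gamma\Rightarrow\psi^u,\Delta$; - $\vee\mathsf L$: $\Gamma,(\varphi\vee\psi)^u\Rightarrow\Delta \leftarrow \Gamma,\varphi^u\Rightarrow\Delta;\ \Gamma,\psi^u\Rightarrow\Delta$; $\vee\mathsf R$: $\Gamma\Rightarrow(\varphi\vee\psi)^u,\Delta \leftarrow \Gamma\Rightarrow\varphi^u,\psi^u,\Delta$; - ${\to}\mathsf L$: $\Gamma,(\varphi\to\psi)^u\Rightarrow\Delta \leftarrow \Gamma\Rightarrow\varphi^u,\Delta;\ \Gamma,\psi^u\Rightarrow\Delta$; ${\to}\mathsf R$: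 $\Gamma\Rightarrow(\varphi\to\psi)^u,\Delta \leftarrow \Gamma,\varphi^u\Rightarrow\psi^u$; - $\mathsf u$: $\Gamma\Rightarrow\varphi^f,\Delta \leftarrow \Gamma\Rightarrow\varphi^u,\Delta$; $\mathsf f$: $\Gamma\Rightarrow\varphi^u,\Delta \leftarrow \Gamma\Rightarrow\varphi^f,\Delta$; - $\mathsf K_a$: $\Pi,K_a\Gamma\Rightarrow (K_a\varphi)^x,\Theta \leftarrow \Gamma\Rightarrow\varphi^x$; $\mathsf T_a$: $\Gamma,(K_a\varphi)^u\Rightarrow\Delta \leftarrow \Gamma,\varphi^u\Rightarrow\Delta$; - $\mathsf{S4}_a$: $\Pi,K_a\Gamma\Rightarrow (K_a\varphi)^x,\Theta \leftarrow K_a\Gamma\Rightarrow\varphi^x$; $\mathsf{S5}_a$: $\Pi,K_a\Gamma\Rightarrow (K_a\varphi)^x,K_a\Delta,\Theta \leftarrow K_a\Gamma\Rightarrow\varphi^x,K_a\Delta$; - $\mathsf K_a{\to}$: $\Gamma\Rightarrow(K_a\varphi\to\psi)^u,\Delta \leftarrow \Gamma,(K_a\varphi)^u\Rightarrow\psi^u,\Delta$;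 - $\mathsf{CL}$: $\Gamma,(C\varphi)^u\Rightarrow\Delta \leftarrow \Gamma,\varphi^u,\{(K_aC\varphi)^u\}_{a\in\mathcal A}\Rightarrow\Delta$; - $\mathsf{CR}$: $\Gamma\Rightarrow(C\varphi)^x,\Delta \leftarrow \Gamma\Rightarrow\varphi^u,\Delta;\ \{\Gamma\Rightarrow(K_aC\varphi)^x,\Delta\}_{a\in\mathcal A}$, with principal formula $(C\varphi)^x$; - $\mathsf{cut}$: $\Gamma\Rightarrow\Delta \leftarrow \Gamma,\varphi^u\Rightarrow\Delta;\ \Gamma\Rightarrow\varphi^u,\Delta$. **Calculi.** $\mathrm{cICK}$ has the rules $\mathsf{id},\bot,\wedge\mathsf L,\wedge\mathsf R,\vee\mathsf L,\vee\mathsf R,{\to}\mathsf L,{\to}\mathsf R,\mathsf u,\mathsf f,\mathsf{CL},\mathsf{CR}$ and all $\mathsf K_a$. $\mathrm{cICKT}$ adds all $\mathsf T_a$ to $\mathrm{cICK}$. $\mathrm{cICKS4}$ is $\mathrm{cICKT}$ with $\mathsf K_a$ replaced by $\mathsf{S4}_a$. $\mathrm{cICKS5}$ is $\mathrm{cICKS4}$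 with $\mathsf{S4}_a$ replaced by $\mathsf{S5}_a$, together with all $\mathsf K_a{\to}$ and $\mathsf{cut}$. **Proofs.** A *cyclic $\mathrm P$-proof* of $\sigma$ is a finite tree labelled by sequents according to the rules of $\mathrm P$, with root labelled $\sigma$, such that each leaf $l$ either is an axiom or has a proper ancestor $c(l)$ with the same label such that on the path from $c(l)$ to $l$ every sequent has a formula in focus and the path passes through an instance of $\mathsf{CR}$ whose principal formula is in focus. $\sigma$ is *$\mathrm P$-provable* if it has a cyclic $\mathrm P$-proof. A *$\Sigma$-proof* is a cyclic $\mathrm P$-proof in which only $\Sigma$-sequents occur. It is *uniform* if there is a function $g$ from $\Sigma$-sequents to rule instances of $\mathrm P$ involving only $\Sigma$-sequents, such that every sequent $\tau$ that is the conclusion of a rule instance (possibly an axiom) in the proof is so by the instance $g(\tau)$. **Game.** For a $\Sigma$-sequent $\sigma$, the game $\mathscr G(\mathrm P,\sigma)$ has as positions the $\Sigma$-sequents and the $\Sigma$-rule positions, i.e. the triples $\langle\tau,\mathsf r,\langle\tau_1,\dots,\tau_n\rangle\rangle$ of $\Sigma$-sequents that are instances of rules $\mathsf r$ of $\mathrm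 P$. It starts in $\sigma$. A sequent $\tau$ belongs to Prover, who moves to a $\Sigma$-rule position with conclusion $\tau$; a rule position belongs to Refuter, who moves to one of its premises. Sequents without a formula in focus have priority 3, instances of $\mathsf{CR}$ with principal formula in focus have priority 2, and all other positions have priority 1. A play is finite, ending in a position whose owner cannot move, or infinite. Prover wins a finite play if it ends in a position of Refuter, and an infinite play if the highest priority encountered infinitely often is even; Refuter wins the other plays. A *memoryless strategy* for Prover is a partial function on positions that maps each position owned by Prover to an admissible move if there is one; it is *winning* if Prover wins every play from $\sigma$ in which it is used. **Theorem.** Let $\mathrm P\in\{\mathrm{cICK},\mathrm{cICKT},\mathrm{cICKS4},\mathrm{cICKS5}\}$, let $\Sigma$ be a finite set of formulae which is closed (negation closed if $\mathrm P=\mathrm{cICKS5}$), and let $\sigma$ be a $\Sigma$-sequent. The following are equivalent: 1. $\sigma$ is $\mathrm P$-provable. 2. $\sigma$ has a $\Sigma$-proof in $\mathrm P$. 3. Prover has a memoryless winning strategy in $\mathscr G(\mathrm P,\sigma)$. 4. $\sigma$ has a uniform $\Sigma$-proof in $\mathrm P$. -/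

import Mathlib

namespace ICK

/-- Formulae of intuitionistic common knowledge logic over the agents `A` and the atoms `At`. -/
inductive Formula (A At : Type*) : Type _
  | bot : Formula A At
  | atom (p : At) : Formula A At
  | and (φ ψ : Formula A At) : Formula A At
  | or (φ ψ : Formula A At) : Formula A At
  | imp (φ ψ : Formula A At) : Formula A At
  | know (a : A) (φ : Formula A At) : Formula A At
  | common (φ : Formula A At) : Formula A At

/-- `¬ φ` abbreviates `φ → ⊥`. -/
abbrev Formula.neg {A At : Type*} (φ : Formula A At) : Formula A At := .imp φ .bot

/-- Closed sets of formulae. -/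
structure IsClosedSet {A At : Type*} (S : Set (Formula A At)) : Prop where
  and_mem : ∀ φ ψ, Formula.and φ ψ ∈ S → φ ∈ S ∧ ψ ∈ S
  or_mem : ∀ φ ψ, Formula.or φ ψ ∈ S → φ ∈ S ∧ ψ ∈ S
  imp_mem : ∀ φ ψ, Formula.imp φ ψ ∈ S → φ ∈ S ∧ ψ ∈ S
  know_mem : ∀ a φ, Formula.know a φ ∈ S → φ ∈ S
  common_mem : ∀ φ, Formula.common φ ∈ S →
    φ ∈ S ∧ ∀ a, Formula.know a (.common φ) ∈ S

/-- Negation closed sets of formulae. -/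
structure IsNegClosedSet {A At : Type*} (S : Set (Formula A At)) : Prop extends
    IsClosedSet S where
  neg_know_mem : ∀ a φ, Formula.know a φ ∈ S → (Formula.know a φ).neg ∈ S

/-- Annotations: unfocused and in focus. -/
inductive Ann : Type
  | unfoc : Ann
  | foc : Ann

/-- Annotated formulae. -/
abbrev AFormula (A At : Type*) : Type _ := Formula A At × Ann

/-- Pairs `Γ ⇒ Δ` of finite sets of annotated formulae. -/
@[ext] structure PreSequent (A At : Type*) : Type _ where
  left : Finset (AFormula A At)
  right : Finset (AFormula A At)

/-- The formulae that may be in focus: `C ψ` and `K_a C ψ`. -/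
def Formula.Focusable {A At : Type*} (φ : Formula A At) : Prop :=
  (∃ ψ, φ = .common ψ) ∨ ∃ a ψ, φ = .know a (.common ψ)

/-- Sequents. -/
@[ext] structure Sequent (A At : Type*) : Type _ extends PreSequent A At where
  left_unfocused : ∀ φ : Formula A At, (φ, Ann.foc) ∉ left
  focus_unique : ∀ φ ψ : Formula A At,
    (φ, Ann.foc) ∈ right → (ψ, Ann.foc) ∈ right → φ = ψ
  focusable : ∀ φ : Formula A At, (φ, Ann.foc) ∈ right → φ.Focusable

/-- Some formula of the sequent is in focus. -/
def Sequent.HasFocus {A At : Type*} (σ : Sequent A At) : Prop :=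
  ∃ φ : Formula A At, (φ, Ann.foc) ∈ σ.right

/-- `σ` is an `S`-sequent: all its formulae, stripped of annotations, belong to `S`. -/
def Sequent.IsOver {A At : Type*} (S : Finset (Formula A At)) (σ : Sequent A At) : Prop :=
  ∀ φ : Formula A At, ∀ b : Ann, (φ, b) ∈ σ.left ∨ (φ, b) ∈ σ.right → φ ∈ S

/-- Names of the inference rules. -/
inductive RuleName (A : Type*) : Type _
  | ax : RuleName A
  | bot : RuleName A
  | andL : RuleName A
  | andR : RuleName A
  | orL : RuleName A
  | orR : RuleName A
  | impL : RuleName A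
  | impR : RuleName A
  | unfocus : RuleName A
  | focus : RuleName A
  | ruleK (a : A) : RuleName A
  | ruleT (a : A) : RuleName A
  | ruleS4 (a : A) : RuleName A
  | ruleS5 (a : A) : RuleName A
  | knowImp (a : A) : RuleName A
  | commonL : RuleName A
  | commonR : RuleName A
  | cut : RuleName A

open scoped Classical in
/-- `K_a Γ`; annotations are kept. -/
noncomputable def knowSet {A At : Type*} (a : A) (Γ : Finset (AFormula A At)) :
    Finset (AFormula A At) :=
  Γ.image fun x => (Formula.know a x.1, x.2)

open scoped Classical in
/-- The premises of the right unfolding rule for the principal formula `C φ` with annotation `b`: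
`Γ ⇒ φ^u, Δ` followed by `Γ ⇒ (K_a C φ)^b, Δ` for every agent `a`. -/
noncomputable def commonRPremises {A At : Type*} [Fintype A] (Γ Δ : Finset (AFormula A At))
    (φ : Formula A At) (b : Ann) : List (PreSequent A At) :=
  ⟨Γ, insert (φ, .unfoc) Δ⟩ ::
    (Finset.univ : Finset A).toList.map fun a =>
      ⟨Γ, insert (Formula.know a (.common φ), b) Δ⟩

open scoped Classical in
/-- `Rule r σ [σ₁, …, σₙ]`: the rule `r` allows to infer `σ` from `σ₁, …, σₙ`. Commas denote unions
of sets, so a context may contain the principal formula. -/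
inductive Rule {A At : Type*} [Fintype A] :
    RuleName A → PreSequent A At → List (PreSequent A At) → Prop
  | ax (Γ Δ : Finset (AFormula A At)) (φ : Formula A At) (b : Ann) :
      Rule .ax ⟨insert (φ, .unfoc) Γ, insert (φ, b) Δ⟩ []
  | bot (Γ Δ : Finset (AFormula A At)) :
      Rule .bot ⟨insert (.bot, .unfoc) Γ, Δ⟩ []
  | andL (Γ Δ : Finset (AFormula A At)) (φ ψ : Formula A At) :
      Rule .andL ⟨insert (.and φ ψ, .unfoc) Γ, Δ⟩
        [⟨insert (φ, .unfoc) (insert (ψ, .unfoc) Γ), Δ⟩]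
  | andR (Γ Δ : Finset (AFormula A At)) (φ ψ : Formula A At) :
      Rule .andR ⟨Γ, insert (.and φ ψ, .unfoc) Δ⟩
        [⟨Γ, insert (φ, .unfoc) Δ⟩, ⟨Γ, insert (ψ, .unfoc) Δ⟩]
  | orL (Γ Δ : Finset (AFormula A At)) (φ ψ : Formula A At) :
      Rule .orL ⟨insert (.or φ ψ, .unfoc) Γ, Δ⟩
        [⟨insert (φ, .unfoc) Γ, Δ⟩, ⟨insert (ψ, .unfoc) Γ, Δ⟩]
  | orR (Γ Δ : Finset (AFormula A At)) (φ ψ : Formula A At) :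
      Rule .orR ⟨Γ, insert (.or φ ψ, .unfoc) Δ⟩
        [⟨Γ, insert (φ, .unfoc) (insert (ψ, .unfoc) Δ)⟩]
  | impL (Γ Δ : Finset (AFormula A At)) (φ ψ : Formula A At) :
      Rule .impL ⟨insert (.imp φ ψ, .unfoc) Γ, Δ⟩
        [⟨Γ, insert (φ, .unfoc) Δ⟩, ⟨insert (ψ, .unfoc) Γ, Δ⟩]
  | impR (Γ Δ : Finset (AFormula A At)) (φ ψ : Formula A At) :
      Rule .impR ⟨Γ, insert (.imp φ ψ, .unfoc) Δ⟩
        [⟨insert (φ, .unfoc) Γ, {(ψ, .unfoc)}⟩]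
  | unfocus (Γ Δ : Finset (AFormula A At)) (φ : Formula A At) :
      Rule .unfocus ⟨Γ, insert (φ, .foc) Δ⟩ [⟨Γ, insert (φ, .unfoc) Δ⟩]
  | focus (Γ Δ : Finset (AFormula A At)) (φ : Formula A At) :
      Rule .focus ⟨Γ, insert (φ, .unfoc) Δ⟩ [⟨Γ, insert (φ, .foc) Δ⟩]
  | ruleK (a : A) (Γ Ξ Θ : Finset (AFormula A At)) (φ : Formula A At) (b : Ann) :
      Rule (.ruleK a) ⟨Ξ ∪ knowSet a Γ, insert (.know a φ, b) Θ⟩ [⟨Γ, {(φ, b)}⟩]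
  | ruleT (a : A) (Γ Δ : Finset (AFormula A At)) (φ : Formula A At) :
      Rule (.ruleT a) ⟨insert (.know a φ, .unfoc) Γ, Δ⟩ [⟨insert (φ, .unfoc) Γ, Δ⟩]
  | ruleS4 (a : A) (Γ Ξ Θ : Finset (AFormula A At)) (φ : Formula A At) (b : Ann) :
      Rule (.ruleS4 a) ⟨Ξ ∪ knowSet a Γ, insert (.know a φ, b) Θ⟩ [⟨knowSet a Γ, {(φ, b)}⟩]
  | ruleS5 (a : A) (Γ Δ Ξ Θ : Finset (AFormula A At)) (φ : Formula A At) (b : Ann) :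
      Rule (.ruleS5 a) ⟨Ξ ∪ knowSet a Γ, insert (.know a φ, b) (knowSet a Δ ∪ Θ)⟩
        [⟨knowSet a Γ, insert (φ, b) (knowSet a Δ)⟩]
  | knowImp (a : A) (Γ Δ : Finset (AFormula A At)) (φ ψ : Formula A At) :
      Rule (.knowImp a) ⟨Γ, insert (.imp (.know a φ) ψ, .unfoc) Δ⟩
        [⟨insert (.know a φ, .unfoc) Γ, insert (ψ, .unfoc) Δ⟩]
  | commonL (Γ Δ : Finset (AFormula A At)) (φ : Formula A At) :
      Rule .commonL ⟨insert (.common φ, .unfoc) Γ, Δ⟩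
        [⟨insert (φ, .unfoc)
            ((Finset.univ : Finset A).image (fun a => (Formula.know a (.common φ), Ann.unfoc)) ∪ Γ),
          Δ⟩]
  | commonR (Γ Δ : Finset (AFormula A At)) (φ : Formula A At) (b : Ann) :
      Rule .commonR ⟨Γ, insert (.common φ, b) Δ⟩ (commonRPremises Γ Δ φ b)
  | cut (Γ Δ : Finset (AFormula A At)) (φ : Formula A At) :
      Rule .cut ⟨Γ, Δ⟩ [⟨insert (φ, .unfoc) Γ, Δ⟩, ⟨Γ, insert (φ, .unfoc) Δ⟩]

/-- The four cyclic calculi. -/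
inductive Calculus : Type
  | cICK : Calculus
  | cICKT : Calculus
  | cICKS4 : Calculus
  | cICKS5 : Calculus

/-- The rules of each calculus. -/
def Calculus.HasRule {A : Type*} : Calculus → RuleName A → Prop
  | .cICK, .ruleK _ => True
  | .cICK, .ruleT _ => False
  | .cICK, .ruleS4 _ => False
  | .cICK, .ruleS5 _ => False
  | .cICK, .knowImp _ => False
  | .cICK, .cut => False
  | .cICKT, .ruleK _ => True
  | .cICKT, .ruleT _ => True
  | .cICKT, .ruleS4 _ => False
  | .cICKT, .ruleS5 _ => False
  | .cICKT, .knowImp _ => False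
  | .cICKT, .cut => False
  | .cICKS4, .ruleK _ => False
  | .cICKS4, .ruleT _ => True
  | .cICKS4, .ruleS4 _ => True
  | .cICKS4, .ruleS5 _ => False
  | .cICKS4, .knowImp _ => False
  | .cICKS4, .cut => False
  | .cICKS5, .ruleK _ => False
  | .cICKS5, .ruleT _ => True
  | .cICKS5, .ruleS4 _ => False
  | .cICKS5, .ruleS5 _ => True
  | .cICKS5, .knowImp _ => True
  | .cICKS5, .cut => True
  | _, _ => True

/-- The closure condition on sets of formulae that goes with each calculus: negation closed for
`cICKS5`, closed for the others. -/
def Calculus.IsClosed {A At : Type*} (P : Calculus) (S : Set (Formula A At)) : Prop :=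
  match P with
  | .cICKS5 => IsNegClosedSet S
  | _ => IsClosedSet S

/-- Triples `⟨σ, r, ⟨σ₁, …, σₙ⟩⟩`. -/
structure RuleTriple (A At : Type*) : Type _ where
  conclusion : Sequent A At
  rule : RuleName A
  premises : List (Sequent A At)

/-- The triple is a rule position (a rule instance) of the calculus `P`. -/
def RuleTriple.IsInstance {A At : Type*} [Fintype A] (P : Calculus) (i : RuleTriple A At) : Prop :=
  P.HasRule i.rule ∧
    Rule i.rule i.conclusion.toPreSequent (i.premises.map Sequent.toPreSequent)

/-- Only `S`-sequents occur in the triple. -/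
def RuleTriple.IsOver {A At : Type*} (S : Finset (Formula A At)) (i : RuleTriple A At) : Prop :=
  i.conclusion.IsOver S ∧ ∀ τ ∈ i.premises, τ.IsOver S

open scoped Classical in
/-- The triple is an instance of the right unfolding rule whose principal formula is in focus. -/
def RuleTriple.IsFocusedCommonR {A At : Type*} [Fintype A] (i : RuleTriple A At) : Prop :=
  i.rule = .commonR ∧ ∃ (Γ Δ : Finset (AFormula A At)) (φ : Formula A At),
    i.conclusion.toPreSequent = ⟨Γ, insert (.common φ, .foc) Δ⟩ ∧
    i.premises.map Sequent.toPreSequent = commonRPremises Γ Δ φ .foc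

/-! ### Cyclic proofs -/

/-- Finite trees: a node is either an `openLeaf`, labelled by a sequent and not the conclusion of a
rule, or a node that is the conclusion of a rule triple, with one child for each premise. Axiomatic
leaves are nodes of the second kind with no premise. -/
inductive ProofTree (A At : Type*) : Type _
  | openLeaf (σ : Sequent A At) : ProofTree A At
  | node (i : RuleTriple A At) (child : Fin i.premises.length → ProofTree A At) : ProofTree A At

namespace ProofTree

variable {A At : Type*}

/-- The sequent labelling the root. -/
def label : ProofTree A At → Sequent A At
  | openLeaf σ => σ
  | node i _ => i.conclusion

/-- The subtree at an address. The addresses `p` with `π.subtree p ≠ none` are the nodes of `π`, and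
there is a path from the node `p` to the node `q` if and only if `p` is a prefix of `q`. -/
def subtree : ProofTree A At → List ℕ → Option (ProofTree A At)
  | t, [] => some t
  | openLeaf _, _ :: _ => none
  | node i child, k :: p =>
      if h : k < i.premises.length then (child ⟨k, h⟩).subtree p else none

/-- `π` is a cyclic pre-proof in `P`: its nodes are labelled according to the rules of `P`. -/
def IsPreProof [Fintype A] (P : Calculus) (π : ProofTree A At) : Prop :=
  ∀ p i child, π.subtree p = some (node i child) →
    i.IsInstance P ∧ ∀ k, (child k).label = i.premises.get k

/-- The path from the node `p` to the node `q` is successful. -/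
def SuccessfulPath [Fintype A] (π : ProofTree A At) (p q : List ℕ) : Prop :=
  p <+: q ∧
  (∀ r t, p <+: r → r <+: q → π.subtree r = some t → t.label.HasFocus) ∧
  ∃ r i child, p <+: r ∧ r <+: q ∧ r ≠ q ∧ π.subtree r = some (node i child) ∧
    i.IsFocusedCommonR

/-- The pair of nodes `(p, q)` is a repetition. -/
def IsRepetition (π : ProofTree A At) (p q : List ℕ) : Prop :=
  p ≠ q ∧ p <+: q ∧ ∃ t s, π.subtree p = some t ∧ π.subtree q = some s ∧ t.label = s.label

/-- `π` is a cyclic proof of `σ` in `P`. -/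
structure IsCyclicProof [Fintype A] (P : Calculus) (π : ProofTree A At) (σ : Sequent A At) :
    Prop where
  preProof : π.IsPreProof P
  root : π.label = σ
  companion : ∀ q τ, π.subtree q = some (openLeaf τ) →
    ∃ p, π.IsRepetition p q ∧ π.SuccessfulPath p q

/-- Every sequent that occurs in `π` is an `S`-sequent. -/
def IsOver (S : Finset (Formula A At)) (π : ProofTree A At) : Prop :=
  ∀ p t, π.subtree p = some t → t.label.IsOver S

end ProofTree

/-- The set of `S`-sequents. -/
abbrev SequentOver {A At : Type*} (S : Finset (Formula A At)) : Type _ :=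
  {τ : Sequent A At // τ.IsOver S}

/-- The set of `S`-rule positions in `P`. -/
abbrev RulePosition {A At : Type*} [Fintype A] (P : Calculus) (S : Finset (Formula A At)) :
    Type _ :=
  {i : RuleTriple A At // i.IsInstance P ∧ i.IsOver S}

/-- `π` is uniform: a function assigns to each `S`-sequent the rule instance of which it is the
conclusion at all its occurrences in `π`. A non-axiomatic leaf is not the conclusion of a rule
instance in `π`, but its companions, which carry the same sequent, are. -/
def ProofTree.IsUniform {A At : Type*} [Fintype A] (P : Calculus) (S : Finset (Formula A At))
    (π : ProofTree A At) : Prop :=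
  ∃ g : SequentOver S → RulePosition P S, ∀ p i child, π.subtree p = some (.node i child) →
    ∀ τ : SequentOver S, i.conclusion = τ.1 → (g τ).1 = i

/-- `σ` is `P`-provable. -/
def Provable {A At : Type*} [Fintype A] (P : Calculus) (σ : Sequent A At) : Prop :=
  ∃ π : ProofTree A At, π.IsCyclicProof P σ

/-- `σ` has an `S`-proof in `P`. -/
def HasProofOver {A At : Type*} [Fintype A] (P : Calculus) (S : Finset (Formula A At))
    (σ : Sequent A At) : Prop :=
  ∃ π : ProofTree A At, π.IsCyclicProof P σ ∧ π.IsOver S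

/-- `σ` has a uniform `S`-proof in `P`. -/
def HasUniformProofOver {A At : Type*} [Fintype A] (P : Calculus) (S : Finset (Formula A At))
    (σ : Sequent A At) : Prop :=
  ∃ π : ProofTree A At, π.IsCyclicProof P σ ∧ π.IsOver S ∧ π.IsUniform P S

/-! ### Parity games -/

/-- The two players. -/
inductive Player : Type
  | prover : Player
  | refuter : Player

/-- Parity games with an initial position. -/
structure ParityGame : Type _ where
  Pos : Type*
  start : Pos
  owner : Pos → Player
  move : Pos → Pos → Prop
  priority : Pos → ℕ

namespace ParityGame

/-- The owner of the position has no admissible move. -/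
def DeadEnd (G : ParityGame) (v : G.Pos) : Prop := ∀ w, ¬ G.move v w

/-- The finite plays: sequences `m 0, …, m n` that end in a dead end. -/
structure IsFinitePlay (G : ParityGame) (n : ℕ) (m : Fin (n + 1) → G.Pos) : Prop where
  start : m 0 = G.start
  move : ∀ k : Fin n, G.move (m k.castSucc) (m k.succ)
  deadEnd : G.DeadEnd (m (Fin.last n))

/-- The infinite plays. -/
structure IsInfinitePlay (G : ParityGame) (m : ℕ → G.Pos) : Prop where
  start : m 0 = G.start
  move : ∀ k, G.move (m k) (m (k + 1))

/-- `X` wins the finite play `m`: the dead end belongs to the other player. -/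
def WinsFinite (G : ParityGame) (X : Player) (n : ℕ) (m : Fin (n + 1) → G.Pos) : Prop :=
  G.owner (m (Fin.last n)) ≠ X

/-- `X` wins the infinite play `m`: the highest priority encountered infinitely often is even if
`X` is Prover, and odd if `X` is Refuter. -/
def WinsInfinite (G : ParityGame) (X : Player) (m : ℕ → G.Pos) : Prop :=
  ∃ d, IsGreatest {d | ∃ᶠ k in Filter.atTop, G.priority (m k) = d} d ∧
    match X with
    | .prover => Even d
    | .refuter => Odd d

/-- Memoryless strategies for `X`: partial functions on positions that map each position owned by
`X` to an admissible move if there is one. -/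
def IsMemorylessStrategy (G : ParityGame) (X : Player) (s : G.Pos → Option G.Pos) : Prop :=
  ∀ v, G.owner v = X → (∃ w, G.move v w) → ∃ w, s v = some w ∧ G.move v w

/-- The memoryless strategy `s` for `X` is winning: `X` wins every play in which `s` is used. -/
structure IsWinning (G : ParityGame) (X : Player) (s : G.Pos → Option G.Pos) : Prop where
  finite : ∀ n (m : Fin (n + 1) → G.Pos), G.IsFinitePlay n m →
    (∀ k : Fin n, G.owner (m k.castSucc) = X → s (m k.castSucc) = some (m k.succ)) →
    G.WinsFinite X n m
  infinite : ∀ m : ℕ → G.Pos, G.IsInfinitePlay m →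
    (∀ k, G.owner (m k) = X → s (m k) = some (m (k + 1))) →
    G.WinsInfinite X m

/-- `X` has a memoryless winning strategy. -/
def HasMemorylessWinningStrategy (G : ParityGame) (X : Player) : Prop :=
  ∃ s : G.Pos → Option G.Pos, G.IsMemorylessStrategy X s ∧ G.IsWinning X s

end ParityGame

open scoped Classical in
/-- The proof-search game of the `S`-sequent `σ` and the calculus `P`. -/
noncomputable def proofSearchGame {A At : Type*} [Fintype A] (P : Calculus)
    (S : Finset (Formula A At)) (σ : SequentOver S) : ParityGame where
  Pos := SequentOver S ⊕ RulePosition P S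
  start := .inl σ
  owner
    | .inl _ => .prover
    | .inr _ => .refuter
  move
    | .inl τ, .inr i => i.1.conclusion = τ.1
    | .inr i, .inl τ => τ.1 ∈ i.1.premises
    | _, _ => False
  priority
    | .inl τ => if τ.1.HasFocus then 1 else 3
    | .inr i => if i.1.IsFocusedCommonR then 2 else 1

end ICK

/-! The equivalence rests on an explicit winning region. `stepSet P S X Y Z` sends the premises of a
move to `X`, `Y` or `Z` according to the highest priority (1, 2 or 3) met in the sequent and the
rule instance. `winSet` is the nested fixpoint of this operator: least in `Z`, greatest in `Y`,
least in `X`. All these sets live on the finite type of `S`-sequents, so every fixpoint is reached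
after finitely many stages, and the stages serve as ranks.

From an `S`-proof to a strategy: a sequent outside `winSet` drops out at some stage of the greatest
fixpoint. Read as a budget, the stage passes from the conclusion to some premise of each rule
instance, does not grow while the focus is kept, and drops at focused unfoldings. A successful cycle
would lower it forever, so proved sequents are in `winSet` (`ProofTree.Correct.not_refuted`,
`mem_winSet_of_correct`). The stages of the two least fixpoints yield a memoryless winning strategy
on `winSet` (`exists_measure`, `hasMemorylessWinningStrategy_of_mem_winSet`).

From a strategy to a uniform proof: unfold the strategy into a tree, closing a branch at its first
successful repetition. An infinite branch would be a play won by Prover; as there are finitely many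
sequents, it would contain such a repetition (`hasUniformProofOver_of_strategy`).

From a proof to an `S`-proof: every rule except cut keeps closed sets, so only `cICKS5` is an issue.
There the argument goes through semantics. Provable sequents hold in all birelational models whose
accessibility relations are equivalences containing the order, by the same `not_refuted` principle
with budgets that count steps to a world violating `φ` (`Model.not_refutes_of_provable`).
Conversely, subsets of `S` whose sequents are not in `winSet` form a canonical model, which refutes
every `S`-sequent outside `winSet` (`World.sat_canonicalModel_iff`, `mem_winSet_of_provable`). Only
cuts on members of `S` are needed there. -/

namespace ICK

/-! ### Addresses, branches and correctness of cyclic proofs -/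

namespace ProofTree

variable {A At : Type*}

/-- The rule triples at the proper ancestors of the node with the given address, root first. -/
def trail : ProofTree A At → List ℕ → List (RuleTriple A At)
  | _, [] => []
  | openLeaf _, _ :: _ => []
  | node i child, k :: p =>
      if h : k < i.premises.length then i :: (child ⟨k, h⟩).trail p else []

theorem subtree_nil (t : ProofTree A At) : t.subtree [] = some t := by
  cases t <;> rfl

theorem subtree_node_cons {i : RuleTriple A At} {child : Fin i.premises.length → ProofTree A At}
    {k : ℕ} {p : List ℕ} {s : ProofTree A At} (hs : (node i child).subtree (k :: p) = some s) :
    ∃ h : k < i.premises.length, (child ⟨k, h⟩).subtree p = some s := by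
  rw [subtree] at hs
  split at hs
  · exact ⟨_, hs⟩
  · simp at hs

theorem subtree_append (t : ProofTree A At) (p q : List ℕ) :
    t.subtree (p ++ q) = (t.subtree p).bind (·.subtree q) := by
  induction p generalizing t with
  | nil => simp [subtree_nil]
  | cons k p ih =>
    cases t with
    | openLeaf τ => simp [subtree]
    | node i child =>
      simp only [List.cons_append, subtree]
      split
      · exact ih _
      · simp

theorem trail_append (t : ProofTree A At) (p q : List ℕ) {s : ProofTree A At}
    (hs : t.subtree p = some s) : t.trail (p ++ q) = t.trail p ++ s.trail q := by
  induction p generalizing t with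
  | nil =>
    rw [subtree_nil] at hs
    cases hs
    cases s <;> simp [trail]
  | cons k p ih =>
    cases t with
    | openLeaf τ => simp [subtree] at hs
    | node i child =>
      obtain ⟨h, hs⟩ := subtree_node_cons hs
      simp only [List.cons_append, trail, h, dif_pos, ih _ hs]

theorem length_trail (t : ProofTree A At) (p : List ℕ) {s : ProofTree A At}
    (hs : t.subtree p = some s) : (t.trail p).length = p.length := by
  induction p generalizing t with
  | nil => cases t <;> simp [trail]
  | cons k p ih =>
    cases t with
    | openLeaf τ => simp [subtree] at hs
    | node i child =>
      obtain ⟨h, hs⟩ := subtree_node_cons hs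
      simp [trail, h, ih _ hs]

theorem exists_of_subtree_append {t s : ProofTree A At} {p q : List ℕ}
    (hs : t.subtree (p ++ q) = some s) : ∃ u, t.subtree p = some u ∧ u.subtree q = some s := by
  rw [subtree_append] at hs
  exact Option.bind_eq_some_iff.1 hs

theorem exists_node_of_subtree_cons {t s : ProofTree A At} {k : ℕ} {p : List ℕ}
    (hs : t.subtree (k :: p) = some s) :
    ∃ i child, t = node i child ∧ t.trail (k :: p) = i :: (t.trail (k :: p)).tail := by
  cases t with
  | openLeaf τ => simp [subtree] at hs
  | node i child =>
    obtain ⟨h, -⟩ := subtree_node_cons hs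
    exact ⟨i, child, rfl, by simp [trail, h]⟩

theorem mem_trail_iff {t s : ProofTree A At} {p : List ℕ} (hs : t.subtree p = some s)
    {j : RuleTriple A At} :
    j ∈ t.trail p ↔ ∃ r child, r <+: p ∧ r ≠ p ∧ t.subtree r = some (node j child) := by
  constructor
  · intro hj
    obtain ⟨l₁, l₂, hl⟩ := List.append_of_mem hj
    have hlen := length_trail t p hs
    have hlt : l₁.length < p.length := by
      rw [← hlen, hl]; simp
    have hp := List.take_append_drop l₁.length p
    have hs' := hs
    rw [← hp] at hs'
    obtain ⟨u, hu, hus⟩ := exists_of_subtree_append hs'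
    have htr := trail_append t _ (p.drop l₁.length) hu
    rw [hp, hl] at htr
    have hl₁ : l₁.length = (t.trail (p.take l₁.length)).length := by
      rw [length_trail t _ hu, List.length_take]; omega
    have h2 := (List.append_inj htr hl₁).2
    have hne : p.drop l₁.length ≠ [] := by
      intro h0
      rw [List.drop_eq_nil_iff] at h0; omega
    obtain ⟨k, q, hkq⟩ := List.exists_cons_of_ne_nil hne
    rw [hkq] at h2 hus
    obtain ⟨i, child, rfl, hi⟩ := exists_node_of_subtree_cons hus
    rw [hi] at h2
    have : j = i := (List.cons.inj h2).1
    subst this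
    refine ⟨p.take l₁.length, child, List.take_prefix _ _, ?_, hu⟩
    intro h0
    have := congrArg List.length h0
    rw [List.length_take] at this; omega
  · rintro ⟨r, child, ⟨q, rfl⟩, hne, hr⟩
    rw [trail_append t r q hr]
    cases q with
    | nil => simp at hne
    | cons k q =>
      obtain ⟨u, hu, hus⟩ := exists_of_subtree_append hs
      rw [hr] at hu
      cases hu
      obtain ⟨h, -⟩ := subtree_node_cons hus
      simp [trail, h]

/-- A leaf labelled `τ` whose proper ancestors carry the triples `H`, root first, has a companion
and the path from it is successful. -/
def Repeats [Fintype A] (H : List (RuleTriple A At)) (τ : Sequent A At) : Prop :=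
  ∃ H₁ i H₂, H = H₁ ++ i :: H₂ ∧ i.conclusion = τ ∧
    (∀ j ∈ i :: H₂, j.conclusion.HasFocus) ∧ ∃ j ∈ i :: H₂, j.IsFocusedCommonR

/-- Trees that are correct below a branch whose triples are `H`, root first: all triples
satisfy `Q`, labels match, and each open leaf has a successful companion. -/
def Correct [Fintype A] (Q : RuleTriple A At → Prop) :
    List (RuleTriple A At) → ProofTree A At → Prop
  | H, openLeaf τ => Repeats H τ
  | H, node i child => Q i ∧ (∀ k, (child k).label = i.premises.get k) ∧
      ∀ k, Correct Q (H ++ [i]) (child k)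

theorem Correct.subtree [Fintype A] {Q : RuleTriple A At → Prop} {t : ProofTree A At}
    {H : List (RuleTriple A At)} (ht : t.Correct Q H) {p : List ℕ} {s : ProofTree A At}
    (hs : t.subtree p = some s) : s.Correct Q (H ++ t.trail p) := by
  induction p generalizing t H with
  | nil =>
    rw [subtree_nil] at hs
    cases hs
    cases s <;> simpa [trail] using ht
  | cons k p ih =>
    cases t with
    | openLeaf τ => simp [ProofTree.subtree] at hs
    | node i child =>
      obtain ⟨h, hs⟩ := subtree_node_cons hs
      have := ih (ht.2.2 ⟨k, h⟩) hs
      simpa [trail, h] using this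

theorem Repeats.companion [Fintype A] {π : ProofTree A At} {q : List ℕ} {τ : Sequent A At}
    (hq : π.subtree q = some (openLeaf τ)) (hr : Repeats (π.trail q) τ) :
    ∃ p, π.IsRepetition p q ∧ π.SuccessfulPath p q := by
  obtain ⟨H₁, i, H₂, hH, hi, hfoc, j, hj, hjc⟩ := hr
  have hlen := length_trail π q hq
  have hlt : H₁.length < q.length := by
    rw [← hlen, hH]; simp
  have hp := List.take_append_drop H₁.length q
  set p := q.take H₁.length with hpdef
  set q' := q.drop H₁.length with hqdef
  clear_value p q'
  have hplen : p.length = H₁.length := by rw [hpdef, List.length_take]; omega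
  subst hp
  obtain ⟨u, hu, hus⟩ := exists_of_subtree_append hq
  have htr := trail_append π p q' hu
  rw [hH] at htr
  have h2 := (List.append_inj htr (by rw [length_trail π _ hu, hplen])).2
  rw [h2] at hfoc hj
  have hne : q' ≠ [] := by
    rintro rfl
    simp [hplen] at hlt
  have hpne : p ≠ p ++ q' := by simpa using hne
  obtain ⟨k, q'', rfl⟩ := List.exists_cons_of_ne_nil hne
  obtain ⟨i', child, rfl, hi'⟩ := exists_node_of_subtree_cons hus
  rw [hi'] at h2
  have : i = i' := (List.cons.inj h2).1
  subst this
  refine ⟨p, ⟨hpne, List.prefix_append _ _, _, _, hu, hq, hi⟩, List.prefix_append _ _, ?_, ?_⟩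
  · rintro r t ⟨r', rfl⟩ hrq ht
    have hr' : r' <+: k :: q'' := (List.prefix_append_right_inj p).1 hrq
    rw [subtree_append, hu, Option.bind_some] at ht
    by_cases hrne : r' = k :: q''
    · subst hrne
      rw [hus] at ht
      cases ht
      -- The leaf carries the label of its companion, so it is focused as well.
      have := hfoc i (by rw [hi']; simp)
      rwa [hi] at this
    · obtain ⟨e, rfl⟩ | ⟨i₁, c₁, rfl⟩ : (∃ e, t = openLeaf e) ∨ ∃ i c, t = node i c := by
        cases t <;> simp
      · obtain ⟨s, hs⟩ := hr'
        rw [← hs, subtree_append, ht, Option.bind_some] at hus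
        cases s with
        | nil => simp at hs; exact absurd hs hrne
        | cons a s => simp [ProofTree.subtree] at hus
      · exact hfoc i₁ ((mem_trail_iff hus).2 ⟨r', c₁, hr', hrne, ht⟩)
  · obtain ⟨r, c, hr, hrne, hrs⟩ := (mem_trail_iff hus).1 hj
    refine ⟨p ++ r, j, c, List.prefix_append _ _, (List.prefix_append_right_inj p).2 hr,
      by simpa using hrne, ?_, hjc⟩
    rw [subtree_append, hu, Option.bind_some, hrs]

theorem repeats_of_companion [Fintype A] {π : ProofTree A At} {p q : List ℕ} {τ : Sequent A At}
    (hq : π.subtree q = some (openLeaf τ)) (hrep : π.IsRepetition p q)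
    (hsucc : π.SuccessfulPath p q) : Repeats (π.trail q) τ := by
  obtain ⟨hne, ⟨q', rfl⟩, t, s, ht, hs, hts⟩ := hrep
  rw [hq] at hs
  cases hs
  obtain ⟨u, hu, hus⟩ := exists_of_subtree_append hq
  rw [ht] at hu
  cases hu
  cases q' with
  | nil => simp at hne
  | cons k q' =>
    obtain ⟨i, child, rfl, hi⟩ := exists_node_of_subtree_cons hus
    refine ⟨π.trail p, i, _, by rw [trail_append π p _ ht, hi], hts, ?_, ?_⟩
    · intro j hj
      rw [← hi] at hj
      obtain ⟨r, c, hr, hrne, hrs⟩ := (mem_trail_iff hus).1 hj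
      exact hsucc.2.1 (p ++ r) (node j c) (List.prefix_append _ _)
        ((List.prefix_append_right_inj p).2 hr)
        (by rw [subtree_append, ht, Option.bind_some, hrs])
    · obtain ⟨r, j, c, ⟨r', rfl⟩, hr, hrne, hrs, hj⟩ := hsucc.2.2
      rw [← hi]
      refine ⟨j, (mem_trail_iff hus).2 ⟨r', c, (List.prefix_append_right_inj p).1 hr,
        by simpa using hrne, ?_⟩, hj⟩
      rwa [subtree_append, ht, Option.bind_some] at hrs

theorem Correct.isCyclicProof [Fintype A] {P : Calculus} {Q : RuleTriple A At → Prop}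
    (hQ : ∀ i, Q i → i.IsInstance P) {π : ProofTree A At} (h : π.Correct Q []) :
    π.IsCyclicProof P π.label where
  preProof p i child hp := by
    have := h.subtree hp
    exact ⟨hQ i this.1, this.2.1⟩
  root := rfl
  companion q τ hq := by
    have := h.subtree hq
    rw [List.nil_append] at this
    exact Repeats.companion hq this

/-- Passing from addresses to the recursive predicate makes structural induction on the tree
available. -/
theorem IsCyclicProof.correct [Fintype A] {P : Calculus} {Q : RuleTriple A At → Prop}
    {π : ProofTree A At} {σ : Sequent A At} (h : π.IsCyclicProof P σ)
    (hQ : ∀ p i child, π.subtree p = some (node i child) → Q i) : π.Correct Q [] := by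
  have key : ∀ (t : ProofTree A At) (p : List ℕ), π.subtree p = some t →
      t.Correct Q (π.trail p) := by
    intro t
    induction t with
    | openLeaf τ =>
      intro p hp
      obtain ⟨p', h₁, h₂⟩ := h.companion p τ hp
      exact repeats_of_companion hp h₁ h₂
    | node i child ih =>
      intro p hp
      refine ⟨hQ p i child hp, (h.preProof p i child hp).2, fun k => ?_⟩
      have := ih k (p ++ [k.1]) (by
        rw [subtree_append, hp, Option.bind_some, ProofTree.subtree]
        simp [subtree_nil])
      rw [trail_append π p _ hp] at this
      convert this using 2
      cases h : child k <;> simp [trail, h]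
  have := key π [] (subtree_nil π)
  convert this using 1
  cases π <;> rfl

/-- If every triple that satisfies `Q` transmits refutations with budget `n` from its conclusion to
a premise, where the budget does not increase along focused sequents and decreases at focused right
unfoldings, then no sequent with a cyclic proof is refuted. -/
theorem Correct.not_refuted [Fintype A] {Q : RuleTriple A At → Prop}
    {D : ℕ → Sequent A At → Prop}
    (hD : ∀ i, Q i → ∀ n, D n i.conclusion → ∃ τ ∈ i.premises, ∃ m, D m τ ∧
      (i.conclusion.HasFocus → τ.HasFocus → m ≤ n ∧ (i.IsFocusedCommonR → m < n)))
    {π : ProofTree A At} (h : π.Correct Q []) (n : ℕ) : ¬ D n π.label := by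
  -- A refuted node leads down to a leaf and from there back to a refuted proper ancestor. If no
  -- focused unfolding lies between that ancestor and the node, the decrease has already taken place
  -- below the node, whence the strict inequality. At the root there is no ancestor, a
  -- contradiction.
  have key : ∀ (t : ProofTree A At) (H : List (RuleTriple A At)), t.Correct Q H →
      ∀ n, D n t.label → ∃ H₁ i H₂, H = H₁ ++ i :: H₂ ∧
        (∀ j ∈ i :: H₂, j.conclusion.HasFocus) ∧ t.label.HasFocus ∧
        ∃ m, D m i.conclusion ∧ m ≤ n ∧ ((∀ j ∈ i :: H₂, ¬ j.IsFocusedCommonR) → m < n) := by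
    intro t
    induction t with
    | openLeaf τ =>
      rintro H ⟨H₁, i, H₂, rfl, hi, hfoc, j, hj, hjc⟩ n hn
      refine ⟨H₁, i, H₂, rfl, hfoc, ?_, n, ?_, le_rfl, fun hno => absurd hjc (hno j hj)⟩
      · have := hfoc i (by simp)
        rw [hi] at this
        exact this
      · rw [hi]; exact hn
    | node i child ih =>
      rintro H ⟨hQ, hlab, hch⟩ n
      induction n using Nat.strong_induction_on with
      | _ n ihn =>
      intro hn
      obtain ⟨τ, hτ, m, hm, hmn⟩ := hD i hQ n hn
      obtain ⟨k, rfl⟩ := List.mem_iff_get.1 hτ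
      obtain ⟨H₁, i', H₂, hH, hfoc, hlf, m', hm', hle, hlt⟩ :=
        ih k (H ++ [i]) (hch k) m (by rw [hlab]; exact hm)
      rw [hlab] at hlf
      -- If `H₂` is empty, the ancestor found is the node itself: a full cycle has been traversed,
      -- the budget is strictly smaller, and the induction on the budget applies.
      rcases List.eq_nil_or_concat H₂ with rfl | ⟨H₂', i₂, rfl⟩
      · have hii : H = H₁ ∧ i = i' := by
          have := List.append_inj' hH rfl
          simpa using this
        obtain ⟨rfl, rfl⟩ := hii
        have hif := hfoc i (by simp)
        obtain ⟨h₁, h₂⟩ := hmn hif hlf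
        have hlt' : m' < n := by
          by_cases hc : i.IsFocusedCommonR
          · exact hle.trans_lt (h₂ hc)
          · exact (hlt (by simpa using hc)).trans_le h₁
        obtain ⟨H₃, j, H₄, hH', hfoc', hl, m'', hD'', hle'', hlt''⟩ := ihn m' hlt' hm'
        exact ⟨H₃, j, H₄, hH', hfoc', hl, m'', hD'', hle''.trans hlt'.le,
          fun _ => hle''.trans_lt hlt'⟩
      · have hii : H = H₁ ++ i' :: H₂' ∧ i = i₂ := by
          have : H ++ [i] = (H₁ ++ i' :: H₂') ++ [i₂] := by simpa using hH
          have := List.append_inj' this rfl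
          simpa using this
        obtain ⟨rfl, rfl⟩ := hii
        have hif := hfoc i (by simp)
        obtain ⟨h₁, h₂⟩ := hmn hif hlf
        refine ⟨H₁, i', H₂', rfl, fun j hj => hfoc j ?_, hif, m', hm', hle.trans h₁, fun hno => ?_⟩
        · simp only [List.mem_cons, List.concat_eq_append, List.mem_append] at hj ⊢
          tauto
        · by_cases hc : i.IsFocusedCommonR
          · exact hle.trans_lt (h₂ hc)
          · refine (hlt fun j hj => ?_).trans_le h₁
            simp only [List.mem_cons, List.concat_eq_append, List.mem_append, List.not_mem_nil,
              or_false] at hj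
            rcases hj with rfl | hj | rfl
            · exact hno _ (by simp)
            · exact hno _ (by simp [hj])
            · exact hc
  intro hn
  obtain ⟨H₁, i, H₂, hH, -⟩ := key π [] h n hn
  simp at hH

end ProofTree
end ICK

/-! ### The winning region as a nested fixpoint -/

namespace ICK

section Fixpoints

variable {V : Type*} [Finite V]

/-- The iterates increase, and increasing chains of subsets of a finite type are stationary. -/
theorem exists_lfp_eq_iterate (f : Set V →o Set V) : ∃ n, OrderHom.lfp f = f^[n] ∅ := by
  have hmono : Monotone fun n => f^[n] ∅ :=
    f.monotone.monotone_iterate_of_le_map (Set.empty_subset _)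
  obtain ⟨n, hn⟩ := WellFoundedGT.monotone_chain_condition (⟨_, hmono⟩ : ℕ →o Set V)
  refine ⟨n, le_antisymm (OrderHom.lfp_le _ ?_) ?_⟩
  · have := hn (n + 1) (Nat.le_succ n)
    simp only [OrderHom.coe_mk, Function.iterate_succ_apply'] at this
    exact this.ge
  · clear hn
    induction n with
    | zero => exact Set.empty_subset _
    | succ n ih =>
      rw [Function.iterate_succ_apply', ← OrderHom.map_lfp]
      exact f.monotone ih

theorem exists_gfp_eq_iterate (f : Set V →o Set V) : ∃ n, OrderHom.gfp f = f^[n] Set.univ := by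
  have hanti : Antitone fun n => f^[n] Set.univ :=
    f.monotone.antitone_iterate_of_map_le (Set.subset_univ _)
  obtain ⟨n, hn⟩ := WellFoundedGT.monotone_chain_condition
    (⟨fun n => OrderDual.toDual (f^[n] Set.univ), hanti⟩ : ℕ →o (Set V)ᵒᵈ)
  refine ⟨n, le_antisymm ?_ (OrderHom.le_gfp _ ?_)⟩
  · clear hn
    induction n with
    | zero => exact Set.subset_univ _
    | succ n ih =>
      rw [Function.iterate_succ_apply', ← OrderHom.map_gfp]
      exact f.monotone ih
  · have : f^[n] Set.univ = f^[n + 1] Set.univ := hn (n + 1) (Nat.le_succ n)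
    rw [Function.iterate_succ_apply'] at this
    exact this.le

end Fixpoints

variable {A At : Type*}

theorem Sequent.toPreSequent_injective :
    Function.Injective (Sequent.toPreSequent : Sequent A At → PreSequent A At) := by
  intro σ τ h
  cases σ; cases τ; cases h; rfl

instance finite_sequentOver (S : Finset (Formula A At)) : Finite (SequentOver S) := by
  classical
  have : Fintype Ann := ⟨{.unfoc, .foc}, fun b => by cases b <;> simp⟩
  let U : Finset (AFormula A At) := S ×ˢ (Finset.univ : Finset Ann)
  have hU : ∀ τ : SequentOver S, τ.1.left ∈ U.powerset ∧ τ.1.right ∈ U.powerset := by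
    intro τ
    simp only [Finset.mem_powerset]
    exact ⟨fun x hx => Finset.mem_product.2 ⟨τ.2 x.1 x.2 (.inl hx), Finset.mem_univ _⟩,
      fun x hx => Finset.mem_product.2 ⟨τ.2 x.1 x.2 (.inr hx), Finset.mem_univ _⟩⟩
  refine Finite.of_injective (β := U.powerset × U.powerset)
    (fun τ => (⟨_, (hU τ).1⟩, ⟨_, (hU τ).2⟩)) ?_
  intro σ τ h
  simp only [Prod.mk.injEq, Subtype.mk.injEq] at h
  exact Subtype.ext (Sequent.ext h.1 h.2)

section WinningRegion

variable [Fintype A] (P : Calculus) (S : Finset (Formula A At))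

/-- The sequents from which Prover can move so that all premises lie in `Z` if the sequent has no
focus, in `Y` if the move is a focused right unfolding, and in `X` otherwise. -/
def stepSet (X Y Z : Set (SequentOver S)) : Set (SequentOver S) :=
  {τ | ∃ i : RulePosition P S, i.1.conclusion = τ.1 ∧ ∀ τ' : SequentOver S,
    τ'.1 ∈ i.1.premises → (¬ τ.1.HasFocus → τ' ∈ Z) ∧
      (τ.1.HasFocus → i.1.IsFocusedCommonR → τ' ∈ Y) ∧
      (τ.1.HasFocus → ¬ i.1.IsFocusedCommonR → τ' ∈ X)}

theorem stepSet_mono {X X' Y Y' Z Z' : Set (SequentOver S)} (hX : X ⊆ X') (hY : Y ⊆ Y')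
    (hZ : Z ⊆ Z') : stepSet P S X Y Z ⊆ stepSet P S X' Y' Z' := by
  rintro τ ⟨i, hi, h⟩
  exact ⟨i, hi, fun τ' hτ' => ⟨fun a => hZ ((h τ' hτ').1 a), fun a b => hY ((h τ' hτ').2.1 a b),
    fun a b => hX ((h τ' hτ').2.2 a b)⟩⟩

/-- `stepSet` as a monotone function of its first argument. -/
def stepHom (Y Z : Set (SequentOver S)) : Set (SequentOver S) →o Set (SequentOver S) :=
  ⟨fun X => stepSet P S X Y Z, fun _ _ h => stepSet_mono P S h subset_rfl subset_rfl⟩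

/-- The sequents from which Prover can force the play into `Y` or `Z`. -/
def reachSet (Y Z : Set (SequentOver S)) : Set (SequentOver S) := OrderHom.lfp (stepHom P S Y Z)

theorem reachSet_mono {Y Y' Z Z' : Set (SequentOver S)} (hY : Y ⊆ Y') (hZ : Z ⊆ Z') :
    reachSet P S Y Z ⊆ reachSet P S Y' Z' :=
  OrderHom.lfp.monotone fun _ => stepSet_mono P S subset_rfl hY hZ

/-- `reachSet` as a monotone function of its first argument. -/
def reachHom (Z : Set (SequentOver S)) : Set (SequentOver S) →o Set (SequentOver S) :=
  ⟨fun Y => reachSet P S Y Z, fun _ _ h => reachSet_mono P S h subset_rfl⟩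

/-- The sequents from which Prover can force the play into `Z` or into infinitely many focused right
unfoldings. -/
def recurSet (Z : Set (SequentOver S)) : Set (SequentOver S) := OrderHom.gfp (reachHom P S Z)

/-- `recurSet` as a monotone function. -/
def recurHom : Set (SequentOver S) →o Set (SequentOver S) :=
  ⟨recurSet P S, fun _ _ h => OrderHom.gfp.monotone fun _ => reachSet_mono P S subset_rfl h⟩

/-- The winning region of Prover in the proof-search game. -/
def winSet : Set (SequentOver S) := OrderHom.lfp (recurHom P S)

theorem stepSet_reachSet (Y Z : Set (SequentOver S)) :
    stepSet P S (reachSet P S Y Z) Y Z = reachSet P S Y Z :=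
  OrderHom.map_lfp (stepHom P S Y Z)

theorem reachSet_recurSet (Z : Set (SequentOver S)) :
    reachSet P S (recurSet P S Z) Z = recurSet P S Z :=
  OrderHom.map_gfp (reachHom P S Z)

theorem recurSet_winSet : recurSet P S (winSet P S) = winSet P S :=
  OrderHom.map_lfp (recurHom P S)

theorem reachSet_winSet : reachSet P S (winSet P S) (winSet P S) = winSet P S := by
  have := reachSet_recurSet P S (winSet P S)
  rwa [recurSet_winSet] at this

theorem stepSet_winSet : stepSet P S (winSet P S) (winSet P S) (winSet P S) = winSet P S := by
  have := stepSet_reachSet P S (winSet P S) (winSet P S)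
  rwa [reachSet_winSet] at this

theorem winSet_subset_reachSet (Y : Set (SequentOver S)) :
    winSet P S ⊆ reachSet P S (Y ∪ winSet P S) (winSet P S) := by
  conv_lhs => rw [← reachSet_winSet]
  exact reachSet_mono P S Set.subset_union_right subset_rfl

/-- Coinduction: `Y` together with the winning region is a post-fixed point of the operator whose
greatest fixpoint is the winning region. This replaces the construction of explicit cyclic
derivations. -/
theorem subset_winSet_of_subset_reachSet {Y : Set (SequentOver S)}
    (h : Y ⊆ reachSet P S (Y ∪ winSet P S) (winSet P S)) : Y ⊆ winSet P S := by
  have : Y ∪ winSet P S ⊆ recurSet P S (winSet P S) :=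
    OrderHom.le_gfp (reachHom P S (winSet P S))
      (Set.union_subset h (winSet_subset_reachSet P S Y))
  rw [recurSet_winSet] at this
  exact Set.subset_union_left.trans this

/-- The budget of a sequent outside the winning region is a stage of the greatest fixpoint, with `Z`
fixed to the winning region, at which the sequent is already missing. Failure of `stepSet` at the
chosen instance points to a premise that is missing too. -/
theorem mem_winSet_of_correct {π : ProofTree A At}
    (h : π.Correct (fun i => i.IsInstance P ∧ i.IsOver S) []) (hσ : π.label.IsOver S) :
    (⟨π.label, hσ⟩ : SequentOver S) ∈ winSet P S := by
  set W := winSet P S with hW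
  have hfix : OrderHom.gfp (reachHom P S W) = W := recurSet_winSet P S
  obtain ⟨N, hN⟩ := exists_gfp_eq_iterate (reachHom P S W)
  have hsub : ∀ n, W ⊆ (reachHom P S W)^[n] Set.univ := by
    intro n
    induction n with
    | zero => exact Set.subset_univ _
    | succ n ih =>
      rw [Function.iterate_succ_apply']
      nth_rw 1 [← hfix]
      rw [← OrderHom.map_gfp, hfix]
      exact (reachHom P S W).monotone ih
  have hout : ∀ τ ∉ W, τ ∉ (reachHom P S W)^[N] Set.univ := by
    intro τ hτ
    rwa [← hN, hfix]
  by_contra hnot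
  refine h.not_refuted
    (D := fun n τ => ∃ h : τ.IsOver S, ⟨τ, h⟩ ∉ (reachHom P S W)^[n] Set.univ) ?_ N
    ⟨hσ, hout _ hnot⟩
  rintro i ⟨hi, hiS⟩ n ⟨hc, hn⟩
  cases n with
  -- Stage 0 is everything, so no sequent has budget 0.
  | zero => simp at hn
  | succ n =>
    have hn' := hn
    rw [Function.iterate_succ_apply'] at hn
    change _ ∉ reachSet P S _ W at hn
    rw [← stepSet_reachSet] at hn
    have : ¬ ∀ τ' : SequentOver S, τ'.1 ∈ i.premises → _ := fun h => hn ⟨⟨i, hi, hiS⟩, rfl, h⟩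
    push Not at this
    obtain ⟨τ', hτ', h'⟩ := this
    by_cases hf : i.conclusion.HasFocus
    · by_cases hC : i.IsFocusedCommonR
      · refine ⟨τ'.1, hτ', n, ⟨τ'.2, fun hmem => ?_⟩, fun _ _ => ⟨Nat.le_succ n,
          fun _ => Nat.lt_succ_self n⟩⟩
        obtain ⟨_, h3, _⟩ := h' (fun h => absurd hf h) (fun _ _ => hmem)
        exact h3 hC
      · refine ⟨τ'.1, hτ', n + 1, ⟨τ'.2, fun hmem => ?_⟩, fun _ _ => ⟨le_rfl,
          fun h => absurd h hC⟩⟩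
        rw [Function.iterate_succ_apply'] at hmem
        obtain ⟨_, _, h3⟩ := h' (fun h => absurd hf h) (fun _ h => absurd h hC)
        exact h3 hmem
    -- Without focus the budget may grow, so it is reset to the final stage `N`.
    · refine ⟨τ'.1, hτ', N, ⟨τ'.2, hout _ fun hmem => ?_⟩, fun h => absurd h hf⟩
      obtain ⟨h2, _⟩ := h' (fun _ => hmem) (fun h => absurd h hf)
      exact hf h2

/-- `a` is the stage in the outer least fixpoint and `b` the stage in the inner one. Priority 3
lowers `a`, priority 2 keeps `a` from growing and leaves `b` free, and priority 1 lowers the pair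
lexicographically. -/
theorem exists_measure : ∃ a b : SequentOver S → ℕ, ∀ τ ∈ winSet P S,
    ∃ i : RulePosition P S, i.1.conclusion = τ.1 ∧ ∀ τ' : SequentOver S, τ'.1 ∈ i.1.premises →
      τ' ∈ winSet P S ∧ (¬ τ.1.HasFocus → a τ' < a τ) ∧ a τ' ≤ a τ ∧
      (τ.1.HasFocus → ¬ i.1.IsFocusedCommonR → a τ' < a τ ∨ b τ' < b τ) := by
  classical
  set W := winSet P S with hW
  set Z : ℕ → Set (SequentOver S) := fun n => (recurHom P S)^[n] ∅ with hZ
  have hZW : ∀ n, Z n ⊆ W := by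
    intro n
    induction n with
    | zero => exact Set.empty_subset _
    | succ n ih =>
      simp only [hZ, Function.iterate_succ_apply'] at ih ⊢
      conv_rhs => rw [hW, ← recurSet_winSet]
      exact (recurHom P S).monotone ih
  -- The greatest fixpoint needs no stages: its value `Z (n + 1)` is plugged in for `Y`, and the
  -- remaining least fixpoint is again `Z (n + 1)`.
  let f : ℕ → Set (SequentOver S) →o Set (SequentOver S) := fun n => stepHom P S (Z (n + 1)) (Z n)
  have hstep : ∀ n, OrderHom.lfp (f n) = Z (n + 1) := by
    intro n
    have h1 : Z (n + 1) = recurSet P S (Z n) := Function.iterate_succ_apply' _ _ _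
    have h2 := reachSet_recurSet P S (Z n)
    rw [← h1] at h2
    exact h2
  -- Stage 0 is empty, so both ranks are shifted by one.
  let a : SequentOver S → ℕ := fun τ => sInf {n | τ ∈ Z (n + 1)}
  let b : SequentOver S → ℕ := fun τ => sInf {k | τ ∈ (f (a τ))^[k + 1] ∅}
  have ha : ∀ τ n, τ ∈ Z (n + 1) → a τ ≤ n := fun τ n h => Nat.sInf_le h
  have ha' : ∀ τ n, τ ∈ Z n → a τ < n := by
    intro τ n h
    cases n with
    | zero => simp [hZ] at h
    | succ n => exact Nat.lt_succ_of_le (ha τ n h)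
  refine ⟨a, b, fun τ hτ => ?_⟩
  have hτZ : τ ∈ Z (a τ + 1) := by
    obtain ⟨N, hN⟩ := exists_lfp_eq_iterate (recurHom P S)
    have hτN : τ ∈ Z N := by
      have : τ ∈ OrderHom.lfp (recurHom P S) := hτ
      rwa [hN] at this
    have : {n | τ ∈ Z (n + 1)}.Nonempty := by
      cases N with
      | zero => simp [hZ] at hτN
      | succ N => exact ⟨N, hτN⟩
    exact Nat.sInf_mem this
  have hτb : τ ∈ (f (a τ))^[b τ + 1] ∅ := by
    obtain ⟨N, hN⟩ := exists_lfp_eq_iterate (f (a τ))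
    rw [hstep] at hN
    have : {k | τ ∈ (f (a τ))^[k + 1] ∅}.Nonempty := by
      rw [hN] at hτZ
      cases N with
      | zero => simp at hτZ
      | succ N => exact ⟨N, hτZ⟩
    exact Nat.sInf_mem this
  have hiter : ∀ k, (f (a τ))^[k] ∅ ⊆ Z (a τ + 1) := by
    intro k
    rw [← hstep]
    induction k with
    | zero => exact Set.empty_subset _
    | succ k ih =>
      rw [Function.iterate_succ_apply', ← OrderHom.map_lfp]
      exact (f (a τ)).monotone ih
  rw [Function.iterate_succ_apply'] at hτb
  obtain ⟨i, hi, h⟩ := hτb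
  refine ⟨i, hi, fun τ' hτ' => ?_⟩
  obtain ⟨h1, h2, h3⟩ := h τ' hτ'
  by_cases hf : τ.1.HasFocus
  · by_cases hC : i.1.IsFocusedCommonR
    · have := h2 hf hC
      exact ⟨hZW _ this, fun h => absurd hf h, ha _ _ this, fun _ h => absurd hC h⟩
    · have h4 := h3 hf hC
      have h5 := hiter _ h4
      refine ⟨hZW _ h5, fun h => absurd hf h, ha _ _ h5, fun _ _ => ?_⟩
      rcases (ha _ _ h5).lt_or_eq with h6 | h6
      · exact .inl h6
      -- Only when the `a`-ranks agree do the two `b`-ranks refer to the same chain.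
      · right
        have hpos : b τ ≠ 0 := by
          intro h0
          simp [h0] at h4
        obtain ⟨c, hc⟩ := Nat.exists_eq_succ_of_ne_zero hpos
        rw [hc] at h4
        have : b τ' ≤ c := Nat.sInf_le (by rw [Set.mem_ofPred_eq, h6]; exact h4)
        omega
  · have := h1 hf
    exact ⟨hZW _ this, fun _ => ha' _ _ this, (ha' _ _ this).le, fun h => absurd h hf⟩

end WinningRegion
end ICK

/-! ### Winning region, memoryless strategies and uniform proofs -/

namespace ICK

variable {A At : Type*} [Fintype A]

section Strategies

variable {P : Calculus} {S : Finset (Formula A At)}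

theorem frequently_atTop_of_strictMono {p : ℕ → Prop} {f : ℕ → ℕ} (hf : StrictMono f)
    (h : ∃ᶠ k in Filter.atTop, p (f k)) : ∃ᶠ k in Filter.atTop, p k :=
  hf.tendsto_atTop.frequently h

theorem exists_forall_ge_eq_of_antitone {f : ℕ → ℕ} (hf : ∀ k, f (k + 1) ≤ f k) :
    ∃ N, ∀ k ≥ N, f k = f N := by
  have hf' := antitone_nat_of_succ_le hf
  obtain ⟨N, hN⟩ := WellFounded.has_min (wellFounded_lt : WellFounded (α := ℕ) (· < ·))
    (Set.range f) ⟨_, 0, rfl⟩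
  obtain ⟨⟨n, rfl⟩, hn⟩ := hN
  exact ⟨n, fun k hk => le_antisymm (hf' hk) (not_lt.1 (hn _ ⟨k, rfl⟩))⟩

/-- Playing the rank-respecting instance keeps the play in the winning region. The rank `a` is
eventually constant, so from some point on all sequents are focused; if focused unfoldings stopped,
`b` would decrease forever. Hence 2 is the highest recurring priority. -/
theorem hasMemorylessWinningStrategy_of_mem_winSet {σ : SequentOver S} (hσ : σ ∈ winSet P S) :
    (proofSearchGame P S σ).HasMemorylessWinningStrategy .prover := by
  classical
  obtain ⟨a, b, h⟩ := exists_measure P S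
  have : Nonempty (RulePosition P S) := ⟨(h σ hσ).choose⟩
  choose! g hg hg' using h
  set W := winSet P S with hW
  set G := proofSearchGame P S σ with hG
  let s : SequentOver S ⊕ RulePosition P S → Option (SequentOver S ⊕ RulePosition P S)
    -- A strategy must move wherever a move exists, so an arbitrary instance is chosen outside the
    -- region.
    | .inl τ => if τ ∈ W then some (.inr (g τ)) else
        if h : ∃ i : RulePosition P S, i.1.conclusion = τ.1 then some (.inr h.choose) else none
    | .inr _ => none
  have hsW : ∀ τ ∈ W, s (.inl τ) = some (.inr (g τ)) := fun τ hτ => if_pos hτ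
  let I : SequentOver S ⊕ RulePosition P S → Prop
    | .inl τ => τ ∈ W
    | .inr i => ∃ τ ∈ W, i = g τ
  have hI : ∀ v w : G.Pos, I v → G.move v w → (G.owner v = .prover → s v = some w) → I w := by
    rintro (τ | i) (τ' | i') hv hm hs
    · exact hm.elim
    · have := (hsW τ hv).symm.trans (hs rfl)
      exact ⟨τ, hv, (Sum.inr.inj (Option.some.inj this)).symm⟩
    · obtain ⟨τ, hτ, rfl⟩ := hv
      exact (hg' τ hτ τ' hm).1
    · exact hm.elim
  refine ⟨s, ?_, ?_, ?_⟩
  · rintro (τ | i) hv ⟨(τ' | i), hm⟩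
    · exact hm.elim
    · by_cases hτ : τ ∈ W
      · exact ⟨_, hsW τ hτ, hg τ hτ⟩
      · have h : ∃ i : RulePosition P S, i.1.conclusion = τ.1 := ⟨i, hm⟩
        refine ⟨.inr h.choose, ?_, h.choose_spec⟩
        simp only [s, if_neg hτ, dif_pos h]
        rfl
    · cases hv
    · cases hv
  · intro n m hm hs hown
    have hinv : ∀ k, I (m k) := by
      intro k
      induction k using Fin.induction with
      | zero => rw [hm.start]; exact hσ
      | succ k ih => exact hI _ _ ih (hm.move k) (hs k)
    have h1 := hinv (Fin.last n)
    have h2 := hm.deadEnd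
    generalize m (Fin.last n) = v at *
    rcases v with τ | i
    · exact h2 (.inr (g τ)) (hg τ h1)
    · cases hown
  · intro m hm hs
    have hinv : ∀ k, I (m k) := by
      intro k
      induction k with
      | zero => rw [hm.start]; exact hσ
      | succ k ih => exact hI _ _ ih (hm.move k) (hs k)
    have hodd : ∀ k τ, m k = .inl τ → m (k + 1) = .inr (g τ) ∧
        ∃ τ' : SequentOver S, m (k + 2) = .inl τ' ∧ τ'.1 ∈ (g τ).1.premises := by
      intro k τ hk
      have h1 : I (m k) := hinv k
      have h2 := hs k
      rw [hk] at h1 h2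
      have h3 : m (k + 1) = .inr (g τ) := by
        have := (hsW τ h1).symm.trans (h2 rfl)
        exact (Option.some.inj this).symm
      refine ⟨h3, ?_⟩
      have h4 := hm.move (k + 1)
      rw [h3] at h4
      generalize m (k + 1 + 1) = w at *
      rcases w with τ' | i
      · exact ⟨τ', rfl, h4⟩
      · exact h4.elim
    have heven : ∀ k, ∃ τ : SequentOver S, m (2 * k) = .inl τ := by
      intro k
      induction k with
      | zero => exact ⟨σ, hm.start⟩
      | succ k ih =>
        obtain ⟨τ, hτ⟩ := ih
        obtain ⟨τ', hτ', -⟩ := (hodd _ τ hτ).2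
        exact ⟨τ', hτ'⟩
    choose t ht using heven
    have htW : ∀ k, t k ∈ W := by
      intro k
      have : I (m (2 * k)) := hinv _
      rwa [ht] at this
    have ht1 : ∀ k, m (2 * k + 1) = .inr (g (t k)) := fun k => (hodd _ _ (ht k)).1
    have hnext : ∀ k, (t (k + 1)).1 ∈ (g (t k)).1.premises := by
      intro k
      obtain ⟨τ', hτ', hp⟩ := (hodd _ _ (ht k)).2
      have : t (k + 1) = τ' := Sum.inl.inj ((ht (k + 1)).symm.trans hτ')
      rwa [this]
    have hmeas := fun k => hg' (t k) (htW k) (t (k + 1)) (hnext k)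
    obtain ⟨N, hN⟩ := exists_forall_ge_eq_of_antitone (f := fun k => a (t k))
      fun k => (hmeas k).2.2.1
    have hconst : ∀ k ≥ N, a (t (k + 1)) = a (t k) := fun k hk =>
      (hN (k + 1) (by omega)).trans (hN k hk).symm
    have hfoc : ∀ k ≥ N, (t k).1.HasFocus := by
      intro k hk
      by_contra hf
      have := (hmeas k).2.1 hf
      rw [hconst k hk] at this
      exact lt_irrefl _ this
    have hprog : ∃ᶠ k in Filter.atTop, (g (t k)).1.IsFocusedCommonR := by
      rw [Filter.frequently_atTop]
      intro M
      by_contra! hno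
      have hdec : ∀ j, b (t (max M N + j)) + j ≤ b (t (max M N)) := by
        intro j
        induction j with
        | zero => simp
        | succ j ih =>
          have h1 := (hmeas (max M N + j)).2.2.2 (hfoc _ (by omega)) (hno _ (by omega))
          rw [hconst _ (by omega)] at h1
          have h2 := h1.resolve_left (lt_irrefl _)
          have h3 : t (max M N + (j + 1)) = t (max M N + j + 1) := rfl
          rw [h3]
          omega
      have := hdec (b (t (max M N)) + 1)
      omega
    refine ⟨2, ⟨?_, ?_⟩, even_two⟩
    · refine frequently_atTop_of_strictMono (f := fun k => 2 * k + 1)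
        (fun x y h => by dsimp; omega) (hprog.mono fun k hk => ?_)
      rw [ht1]
      exact if_pos hk
    · intro d hd
      have hle : ∀ᶠ k in Filter.atTop, G.priority (m k) ≤ 2 := by
        filter_upwards [Filter.eventually_ge_atTop (2 * N)] with k hk
        obtain ⟨j, rfl | rfl⟩ := k.even_or_odd'
        · rw [ht]
          change (if (t j).1.HasFocus then 1 else 3) ≤ 2
          rw [if_pos (hfoc j (by omega))]
          norm_num
        · rw [ht1]
          change (if (g (t j)).1.IsFocusedCommonR then 2 else 1) ≤ 2
          split <;> norm_num
      obtain ⟨k, hk, hk'⟩ := (hd.and_eventually hle).exists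
      rwa [hk] at hk'

theorem exists_path_of_reflTransGen {α : Type*} {r : α → α → Prop} {x y : α}
    (h : Relation.ReflTransGen r x y) :
    ∃ (n : ℕ) (m : ℕ → α), m 0 = x ∧ m n = y ∧ ∀ k < n, r (m k) (m (k + 1)) := by
  induction h using Relation.ReflTransGen.head_induction_on with
  | refl => exact ⟨0, fun _ => y, rfl, rfl, by simp⟩
  | @head u c hac _ ih =>
    obtain ⟨n, m, h0, hn, hm⟩ := ih
    refine ⟨n + 1, fun k => k.casesOn u m, rfl, hn, fun k hk => ?_⟩
    cases k with
    | zero => simpa [h0] using hac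
    | succ k => exact hm k (by omega)

/-- Uniformity comes for free: the tree applies the instance chosen by a memoryless strategy, so
this instance depends on the sequent alone. -/
theorem hasUniformProofOver_of_strategy {σ : SequentOver S}
    (h : (proofSearchGame P S σ).HasMemorylessWinningStrategy .prover) :
    HasUniformProofOver P S σ.1 := by
  classical
  set G := proofSearchGame P S σ with hG
  obtain ⟨s, hs, hwin⟩ := h
  let r : G.Pos → G.Pos → Prop := fun v w => G.move v w ∧ (G.owner v = .prover → s v = some w)
  have hmove : ∀ τ : SequentOver S, Relation.ReflTransGen r G.start (.inl τ) →
      ∃ i : RulePosition P S, s (.inl τ) = some (.inr i) ∧ i.1.conclusion = τ.1 := by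
    intro τ hτ
    by_cases hex : ∃ w, G.move (.inl τ) w
    · obtain ⟨w, hw, hw'⟩ := hs (.inl τ) rfl hex
      rcases w with τ' | i
      · exact hw'.elim
      · exact ⟨i, hw, hw'⟩
    -- A reachable sequent without a move would end a finite play that Prover loses.
    · obtain ⟨n, m, h0, hn, hm⟩ := exists_path_of_reflTransGen hτ
      have := hwin.finite n (fun k => m k) ⟨h0, fun k => (hm k k.2).1, fun w hw => hex ⟨w, ?_⟩⟩
        fun k => (hm k k.2).2
      · refine absurd ?_ this
        simp only [Fin.val_last, hn]
        rfl
      · simp only [Fin.val_last, hn] at hw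
        exact hw
  obtain ⟨i₀, -⟩ := hmove σ .refl
  let g : SequentOver S → RulePosition P S := fun τ =>
    if h : ∃ i : RulePosition P S, s (.inl τ) = some (.inr i) ∧ i.1.conclusion = τ.1
      then h.choose else i₀
  have hg : ∀ τ : SequentOver S, Relation.ReflTransGen r G.start (.inl τ) →
      s (.inl τ) = some (.inr (g τ)) ∧ (g τ).1.conclusion = τ.1 := by
    intro τ hτ
    have h := hmove τ hτ
    have : g τ = h.choose := dif_pos h
    rw [this]
    exact h.choose_spec
  have hstep : ∀ τ τ' : SequentOver S, Relation.ReflTransGen r G.start (.inl τ) →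
      τ'.1 ∈ (g τ).1.premises → Relation.ReflTransGen r G.start (.inl τ') := by
    intro τ τ' hτ hτ'
    obtain ⟨h1, h2⟩ := hg τ hτ
    have e1 : r (.inl τ) (.inr (g τ)) := ⟨h2, fun _ => h1⟩
    have e2 : r (.inr (g τ)) (.inl τ') := ⟨hτ', fun h => by cases h⟩
    exact (hτ.tail e1).tail e2
  -- One step of the unfolding, with the history of the branch. It is blocked at successful
  -- repetitions, so accessibility of the root is termination of the construction.
  let R : List (RuleTriple A At) × SequentOver S → List (RuleTriple A At) × SequentOver S → Prop :=
    fun y x => Relation.ReflTransGen r G.start (.inl x.2) ∧ ¬ ProofTree.Repeats x.1 x.2.1 ∧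
      y.2.1 ∈ (g x.2).1.premises ∧ y.1 = x.1 ++ [(g x.2).1]
  let Q : RuleTriple A At → Prop := fun i => ∃ τ : SequentOver S, i = (g τ).1 ∧
    i.conclusion = τ.1
  have htree : ∀ x, Acc R x → Relation.ReflTransGen r G.start (.inl x.2) →
      ∃ t : ProofTree A At, t.label = x.2.1 ∧ t.Correct Q x.1 := by
    intro x hx
    induction hx with
    | intro x _ ih =>
      intro hreach
      by_cases hrep : ProofTree.Repeats x.1 x.2.1
      · exact ⟨.openLeaf x.2.1, rfl, hrep⟩
      · have hex : ∀ k : Fin (g x.2).1.premises.length, ∃ t : ProofTree A At,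
            t.label = (g x.2).1.premises.get k ∧ t.Correct Q (x.1 ++ [(g x.2).1]) := by
          intro k
          have hk := List.get_mem (g x.2).1.premises k
          exact ih (x.1 ++ [(g x.2).1], ⟨_, (g x.2).2.2.2 _ hk⟩) ⟨hreach, hrep, hk, rfl⟩
            (hstep _ _ hreach hk)
        choose child hlab hcor using hex
        exact ⟨.node (g x.2).1 child, (hg _ hreach).2, ⟨x.2, rfl, (hg _ hreach).2⟩, hlab, hcor⟩
  have hacc : Acc R ([], σ) := by
    by_contra hnot
    obtain ⟨f, hf0, hf⟩ := not_acc_iff_exists_descending_chain.1 hnot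
    set t : ℕ → SequentOver S := fun k => (f k).2 with ht
    let m : ℕ → G.Pos := fun k => if k % 2 = 0 then .inl (t (k / 2)) else .inr (g (t (k / 2)))
    have hm0 : ∀ k, m (2 * k) = .inl (t k) := by
      intro k
      have h1 : 2 * k % 2 = 0 := by omega
      have h2 : 2 * k / 2 = k := by omega
      exact (if_pos h1).trans (by rw [h2])
    have hm1 : ∀ k, m (2 * k + 1) = .inr (g (t k)) := by
      intro k
      have h1 : ¬ (2 * k + 1) % 2 = 0 := by omega
      have h2 : (2 * k + 1) / 2 = k := by omega
      exact (if_neg h1).trans (by rw [h2])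
    have hm2 : ∀ k, m (2 * k + 1 + 1) = .inl (t (k + 1)) := fun k => hm0 (k + 1)
    have hplay : ∀ k, r (m k) (m (k + 1)) := by
      intro k
      obtain ⟨j, rfl | rfl⟩ := k.even_or_odd'
      · rw [hm0, hm1]
        obtain ⟨h1, h2⟩ := hg (t j) (hf j).1
        exact ⟨h2, fun _ => h1⟩
      · rw [hm1, hm2]
        exact ⟨(hf j).2.2.1, fun h => by cases h⟩
    obtain ⟨d, ⟨hd, hub⟩, heven⟩ := hwin.infinite m
      ⟨by rw [← mul_zero 2, hm0, ht]; simp only [hf0]; rfl, fun k => (hplay k).1⟩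
      fun k => (hplay k).2
    have hp0 : ∀ k, G.priority (m (2 * k)) = if (t k).1.HasFocus then 1 else 3 := by
      intro k
      rw [hm0]
      rfl
    have hp1 : ∀ k, G.priority (m (2 * k + 1)) =
        if (g (t k)).1.IsFocusedCommonR then 2 else 1 := by
      intro k
      rw [hm1]
      rfl
    -- The priorities are 1, 2 and 3, and the winning one is even.
    have hd2 : d = 2 := by
      obtain ⟨k, hk⟩ := hd.exists
      have hev : Even d := heven
      obtain ⟨j, rfl | rfl⟩ := k.even_or_odd'
      · rw [hp0] at hk
        split at hk <;> subst hk <;> exact absurd hev (by decide)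
      · rw [hp1] at hk
        split at hk <;> subst hk
        · rfl
        · exact absurd hev (by decide)
    subst hd2
    have hfin : ∀ᶠ k in Filter.atTop, ¬ G.priority (m k) = 3 := by
      rw [← Filter.not_frequently]
      intro h3
      have : 3 ≤ 2 := hub h3
      omega
    obtain ⟨N, hN⟩ := Filter.eventually_atTop.1 hfin
    have hfoc : ∀ j ≥ N, (t j).1.HasFocus := by
      intro j hj
      by_contra hno
      exact hN (2 * j) (by omega) (by rw [hp0, if_neg hno])
    have hprog : ∀ M, ∃ j ≥ M, (g (t j)).1.IsFocusedCommonR := by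
      intro M
      obtain ⟨k, hk, hk2⟩ := Filter.frequently_atTop.1 hd (2 * M)
      obtain ⟨j, rfl | rfl⟩ := k.even_or_odd'
      · rw [hp0] at hk2
        split at hk2 <;> omega
      · rw [hp1] at hk2
        refine ⟨j, by omega, ?_⟩
        by_contra hno
        rw [if_neg hno] at hk2
        omega
    -- Some sequent occurs infinitely often. Two occurrences beyond `N` with a focused unfolding
    -- between them form a successful repetition, at which the branch should have been closed.
    obtain ⟨τ, hτ⟩ := Finite.exists_infinite_fiber t
    have hτ : (t ⁻¹' {τ}).Infinite := Set.infinite_coe_iff.1 hτ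
    obtain ⟨k₀, hk₀, hNk⟩ := hτ.exists_gt N
    obtain ⟨j, hj, hjc⟩ := hprog k₀
    obtain ⟨l, hl, hjl⟩ := hτ.exists_gt j
    have hist : ∀ n, (f (k₀ + n)).1 =
        (f k₀).1 ++ (List.range n).map fun e => (g (t (k₀ + e))).1 := by
      intro n
      induction n with
      | zero => simp
      | succ n ih =>
        rw [← add_assoc, (hf (k₀ + n)).2.2.2, ih, List.range_succ]
        simp [ht]
    obtain ⟨n, rfl⟩ : ∃ n, l = k₀ + (n + 1) := ⟨l - k₀ - 1, by omega⟩
    refine (hf (k₀ + (n + 1))).2.1 ?_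
    have hsplit : ((List.range (n + 1)).map fun e => (g (t (k₀ + e))).1) =
        (g (t k₀)).1 :: ((List.range n).map Nat.succ).map fun e => (g (t (k₀ + e))).1 := by
      rw [List.range_succ_eq_map]
      simp
    refine ⟨(f k₀).1, (g (t k₀)).1, _, by rw [hist, hsplit], ?_, ?_, ?_⟩
    · rw [(hg _ (hf k₀).1).2]
      exact congrArg Subtype.val ((hk₀ : t k₀ = τ).trans (hl : t _ = τ).symm)
    · rw [← hsplit]
      intro i hi
      obtain ⟨e, -, rfl⟩ := List.mem_map.1 hi
      rw [(hg _ (hf (k₀ + e)).1).2]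
      exact hfoc _ (by omega)
    · rw [← hsplit]
      refine ⟨_, List.mem_map.2 ⟨j - k₀, List.mem_range.2 (by omega), rfl⟩, ?_⟩
      rwa [Nat.add_sub_cancel' hj]
  obtain ⟨π, hlab, hcor⟩ := htree _ hacc .refl
  refine ⟨π, ?_, ?_, ?_⟩
  · rw [← hlab]
    refine hcor.isCyclicProof ?_
    rintro _ ⟨τ, rfl, -⟩
    exact (g τ).2.1
  · have hnode : ∀ p i child, π.subtree p = some (.node i child) → i.conclusion.IsOver S := by
      intro p i child hp
      obtain ⟨⟨τ, rfl, -⟩, -⟩ := hcor.subtree hp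
      exact (g τ).2.2.1
    rintro p (τ | ⟨i, child⟩) hp
    -- An open leaf repeats the conclusion of an ancestor, which is an `S`-sequent.
    · obtain ⟨H₁, i, H₂, hH, rfl, -⟩ := hcor.subtree hp
      obtain ⟨q, child, -, -, hq⟩ := (ProofTree.mem_trail_iff hp (j := i)).1 (by
        rw [List.nil_append] at hH
        rw [hH]
        simp)
      exact hnode q i child hq
    · exact hnode p i child hp
  · refine ⟨g, fun p i child hp τ hτ => ?_⟩
    obtain ⟨⟨τ', rfl, hτ'⟩, -⟩ := hcor.subtree hp
    rw [Subtype.ext (hτ.symm.trans hτ' : τ.1 = τ'.1)]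

end Strategies
end ICK

/-! ### Analyticity of the rules other than cut -/

namespace ICK

variable {A At : Type*}


open scoped Classical in
-- The closure conditions match the rules one by one; cut alone introduces a formula with no
-- relation to the conclusion.
theorem Rule.premises_over [Fintype A] {r : RuleName A} {σ : PreSequent A At} {l : List (PreSequent A At)}
    (h : Rule r σ l) (hcut : r ≠ .cut) {S : Set (Formula A At)} (hS : IsClosedSet S)
    (hl : ∀ x ∈ σ.left, x.1 ∈ S) (hr : ∀ x ∈ σ.right, x.1 ∈ S) :
    ∀ τ ∈ l, (∀ x ∈ τ.left, x.1 ∈ S) ∧ ∀ x ∈ τ.right, x.1 ∈ S := by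
  have hK : ∀ (a : A) (Γ : Finset (AFormula A At)), (∀ x ∈ knowSet a Γ, x.1 ∈ S) →
      ∀ x ∈ Γ, x.1 ∈ S := fun a Γ h x hx =>
    hS.know_mem a _ (h _ (Finset.mem_image_of_mem _ hx))
  cases h with
  | ax | bot => simp
  | andL Γ Δ φ ψ | orR Γ Δ φ ψ | orL Γ Δ φ ψ | andR Γ Δ φ ψ | impL Γ Δ φ ψ | impR Γ Δ φ ψ =>
    have h1 := hS.and_mem φ ψ
    have h2 := hS.or_mem φ ψ
    have h3 := hS.imp_mem φ ψ
    simp only [Finset.forall_mem_insert, List.forall_mem_cons, List.not_mem_nil,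
      Finset.mem_singleton, forall_eq] at *
    tauto
  | unfocus Γ Δ φ | focus Γ Δ φ =>
    simp only [Finset.forall_mem_insert, List.forall_mem_cons, List.not_mem_nil] at *
    tauto
  | ruleT a Γ Δ φ =>
    have h1 := hS.know_mem a φ
    simp only [Finset.forall_mem_insert, List.forall_mem_cons, List.not_mem_nil] at *
    tauto
  | ruleK a Γ Ξ Θ φ b | ruleS4 a Γ Ξ Θ φ b =>
    have h1 := hS.know_mem a φ
    have h2 := hK a Γ
    simp only [Finset.forall_mem_insert, List.forall_mem_cons, List.not_mem_nil,
      Finset.forall_mem_union, Finset.mem_singleton, forall_eq] at *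
    tauto
  | ruleS5 a Γ Δ Ξ Θ φ b =>
    have h1 := hS.know_mem a φ
    simp only [Finset.forall_mem_insert, List.forall_mem_cons, List.not_mem_nil,
      Finset.forall_mem_union] at *
    tauto
  | knowImp a Γ Δ φ ψ =>
    have h3 := hS.imp_mem (.know a φ) ψ
    simp only [Finset.forall_mem_insert, List.forall_mem_cons, List.not_mem_nil] at *
    tauto
  | commonL Γ Δ φ =>
    have h1 := hS.common_mem φ
    simp only [Finset.forall_mem_insert, List.forall_mem_cons, List.not_mem_nil,
      Finset.forall_mem_union, Finset.forall_mem_image, Finset.mem_univ, forall_true_left] at *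
    tauto
  | commonR Γ Δ φ b =>
    have h1 := hS.common_mem φ
    simp only [Finset.forall_mem_insert, List.forall_mem_cons, commonRPremises, List.forall_mem_map,
      Finset.mem_toList, Finset.mem_univ, forall_true_left] at *
    tauto
  | cut => exact absurd rfl hcut

theorem Calculus.IsClosed.isClosedSet {P : Calculus} {S : Set (Formula A At)}
    (h : P.IsClosed S) : IsClosedSet S := by
  cases P
  · exact h
  · exact h
  · exact h
  · exact IsNegClosedSet.toIsClosedSet h

theorem Sequent.isOver_iff {S : Finset (Formula A At)} {σ : Sequent A At} :
    σ.IsOver S ↔ (∀ x ∈ σ.left, x.1 ∈ S) ∧ ∀ x ∈ σ.right, x.1 ∈ S :=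
  ⟨fun h => ⟨fun x hx => h x.1 x.2 (.inl hx), fun x hx => h x.1 x.2 (.inr hx)⟩,
    fun h φ b hφ => hφ.elim (h.1 (φ, b)) (h.2 (φ, b))⟩

theorem ProofTree.IsCyclicProof.isOver [Fintype A] {P : Calculus} {S : Finset (Formula A At)}
    (hP : P ≠ .cICKS5) (hS : IsClosedSet (S : Set (Formula A At))) {π : ProofTree A At}
    {σ : Sequent A At} (h : π.IsCyclicProof P σ) (hσ : σ.IsOver S) : π.IsOver S := by
  intro p
  induction p using List.reverseRecOn with
  | nil =>
    intro t ht
    rw [subtree_nil] at ht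
    cases ht
    rwa [h.root]
  | append_singleton p k ih =>
    intro t ht
    obtain ⟨u, hu, hut⟩ := exists_of_subtree_append ht
    cases u with
    | openLeaf τ => simp [subtree] at hut
    | node i child =>
      obtain ⟨hk, hut⟩ := subtree_node_cons hut
      rw [subtree_nil] at hut
      cases hut
      obtain ⟨⟨hrule, hinst⟩, hlab⟩ := h.preProof p i child hu
      have hi : i.conclusion.IsOver S := ih _ hu
      rw [hlab, Sequent.isOver_iff]
      rw [Sequent.isOver_iff] at hi
      refine hinst.premises_over (fun hcut => ?_) hS hi.1 hi.2 _
        (List.mem_map_of_mem (List.get_mem i.premises ⟨k, hk⟩))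
      rw [hcut] at hrule
      cases P <;> simp [Calculus.HasRule] at hrule hP

theorem ProofTree.IsCyclicProof.correct_over [Fintype A] {P : Calculus}
    {S : Finset (Formula A At)}
    {π : ProofTree A At} {σ : Sequent A At} (h : π.IsCyclicProof P σ) (hS : π.IsOver S) :
    π.Correct (fun i => i.IsInstance P ∧ i.IsOver S) [] := by
  refine h.correct fun p i child hp => ?_
  obtain ⟨hi, hlab⟩ := h.preProof p i child hp
  refine ⟨hi, hS p _ hp, fun τ hτ => ?_⟩
  obtain ⟨k, rfl⟩ := List.mem_iff_get.1 hτ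
  rw [← hlab]
  refine hS (p ++ [k.1]) _ ?_
  rw [subtree_append, hp, Option.bind_some, subtree]
  simp [subtree_nil]

end ICK

/-! ### Birelational semantics and soundness of `cICKS5` -/

namespace ICK

variable {A At : Type*}

/-- Birelational models with set of worlds `W`, where the accessibility relations are equivalence
relations that contain the intuitionistic order. -/
structure Model (A At W : Type*) where
  le : W → W → Prop
  rel : A → W → W → Prop
  val : At → W → Prop
  le_refl : ∀ w, le w w
  le_trans : ∀ u v w, le u v → le v w → le u w
  equivalence : ∀ a, Equivalence (rel a)
  rel_of_le : ∀ a v w, le v w → rel a v w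
  val_mono : ∀ p v w, le v w → val p v → val p w

namespace Model

variable {W : Type*} (M : Model A At W)

/-- Truth at a world. -/
def Sat : Formula A At → W → Prop
  | .bot, _ => False
  | .atom p, w => M.val p w
  | .and φ ψ, w => Sat φ w ∧ Sat ψ w
  | .or φ ψ, w => Sat φ w ∨ Sat ψ w
  | .imp φ ψ, w => ∀ v, M.le w v → Sat φ v → Sat ψ v
  | .know a φ, w => ∀ v, M.rel a w v → Sat φ v
  | .common φ, w => ∀ v, Relation.ReflTransGen (fun x y => ∃ a, M.rel a x y) w v → Sat φ v

theorem Sat.mono [Nonempty A] {M : Model A At W} {φ : Formula A At} {v w : W} (hvw : M.le v w)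
    (h : M.Sat φ v) : M.Sat φ w := by
  induction φ with
  | bot => exact h
  | atom p => exact M.val_mono p v w hvw h
  | and φ ψ ih₁ ih₂ => exact ⟨ih₁ h.1, ih₂ h.2⟩
  | or φ ψ ih₁ ih₂ => exact h.imp ih₁ ih₂
  | imp φ ψ => exact fun u hu => h u (M.le_trans _ _ _ hvw hu)
  | know a φ => exact fun u hu => h u ((M.equivalence a).trans (M.rel_of_le a _ _ hvw) hu)
  -- An order step is an accessibility step of any agent, so at least one agent is required.
  | common φ => exact fun u hu => h u (hu.head ⟨Classical.arbitrary A, M.rel_of_le _ _ _ hvw⟩)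

/-- Related worlds see the same worlds. This justifies the side contexts of `ruleS5` and, as the
order is contained in the relation, the rule `knowImp`. -/
theorem sat_know_iff_of_rel {a : A} {φ : Formula A At} {v w : W} (h : M.rel a v w) :
    M.Sat (.know a φ) v ↔ M.Sat (.know a φ) w :=
  ⟨fun hv u hu => hv u ((M.equivalence a).trans h hu),
    fun hw u hu => hw u ((M.equivalence a).trans ((M.equivalence a).symm h) hu)⟩

theorem sat_common_iff {φ : Formula A At} {w : W} :
    M.Sat (.common φ) w ↔ M.Sat φ w ∧ ∀ a, M.Sat (.know a (.common φ)) w := by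
  constructor
  · exact fun h => ⟨h w .refl, fun a v hv u hu => h u (hu.head ⟨a, hv⟩)⟩
  · rintro ⟨h₁, h₂⟩ v hv
    rcases hv.cases_head with rfl | ⟨u, ⟨a, hu⟩, huv⟩
    · exact h₁
    · exact h₂ a u hu v huv

/-- Some world that violates `φ` is reached from `w` in `n` steps. -/
def FailsIn (φ : Formula A At) : ℕ → W → Prop
  | 0, w => ¬ M.Sat φ w
  | n + 1, w => ∃ a v, M.rel a w v ∧ FailsIn φ n v

/-- If `χ` is `C φ` or `K_a C φ`, then `χ` is violated at `w` because of a world violating `φ` that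
is reached in `n` steps, not counting the step for `K_a`. -/
def Budget (n : ℕ) (w : W) : Formula A At → Prop
  | .common φ => M.FailsIn φ n w
  | .know a (.common φ) => ∃ v, M.rel a w v ∧ M.FailsIn φ n v
  | _ => True

theorem exists_failsIn {φ : Formula A At} {w : W} (h : ¬ M.Sat (.common φ) w) :
    ∃ n, M.FailsIn φ n w := by
  simp only [Sat, not_forall] at h
  obtain ⟨v, hv, hφ⟩ := h
  induction hv using Relation.ReflTransGen.head_induction_on with
  | refl => exact ⟨0, hφ⟩
  | head hac _ ih =>
    obtain ⟨a, ha⟩ := hac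
    obtain ⟨n, hn⟩ := ih
    exact ⟨n + 1, a, _, ha, hn⟩

theorem not_sat_of_failsIn {φ : Formula A At} {n : ℕ} {w : W} (h : M.FailsIn φ n w) :
    ¬ M.Sat (.common φ) w := by
  induction n generalizing w with
  | zero => exact fun hw => h (M.sat_common_iff.1 hw).1
  | succ n ih =>
    obtain ⟨a, v, hv, hn⟩ := h
    exact fun hw => ih hn ((M.sat_common_iff.1 hw).2 a v hv)

theorem exists_budget {χ : Formula A At} (hχ : χ.Focusable) {w : W} (h : ¬ M.Sat χ w) :
    ∃ n, M.Budget n w χ := by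
  rcases hχ with ⟨φ, rfl⟩ | ⟨a, φ, rfl⟩
  · exact M.exists_failsIn h
  · simp only [Sat, not_forall] at h
    obtain ⟨v, hv, u, hu, hφ⟩ := h
    obtain ⟨n, hn⟩ := M.exists_failsIn (φ := φ) (w := v) fun hs => hφ (hs u hu)
    exact ⟨n, v, hv, hn⟩

/-- The world `w` satisfies the antecedent and violates the succedent, the formula in focus with
budget `n`. -/
def Refutes (n : ℕ) (σ : PreSequent A At) (w : W) : Prop :=
  (∀ x ∈ σ.left, M.Sat x.1 w) ∧ (∀ x ∈ σ.right, ¬ M.Sat x.1 w) ∧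
    ∀ x ∈ σ.right, x.2 = Ann.foc → M.Budget n w x.1

variable {M}

open scoped Classical in
-- With budget 0 the world itself violates `φ`, which selects the unfocused premise. Otherwise the
-- agent of the first step selects a premise, and that step is no longer counted.
theorem Refutes.exists_premise_of_focused [Fintype A] [Nonempty A] {Γ Δ : Finset (AFormula A At)}
    {φ : Formula A At} {n : ℕ} {w : W}
    (h : M.Refutes n ⟨Γ, insert (.common φ, .foc) Δ⟩ w)
    (hΔ : ∀ ψ, (ψ, Ann.foc) ∉ Δ) :
    ∃ τ ∈ commonRPremises Γ Δ φ .foc, ∃ m w', M.Refutes m τ w' ∧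
      ((∃ χ, (χ, Ann.foc) ∈ τ.right) → m < n) := by
  obtain ⟨h1, h2, h3⟩ := h
  simp only [Finset.forall_mem_insert] at h2 h3
  have hb : M.FailsIn φ n w := h3.1 trivial
  have hΔ' : ∀ m v, ∀ x ∈ Δ, x.2 = Ann.foc → M.Budget m v x.1 := by
    rintro m v ⟨ψ, b⟩ hx rfl
    exact absurd hx (hΔ ψ)
  cases n with
  | zero =>
    refine ⟨_, List.mem_cons_self, 0, w, ⟨h1, ?_, ?_⟩, ?_⟩
    · simp only [Finset.forall_mem_insert]
      exact ⟨hb, h2.2⟩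
    · simp only [Finset.forall_mem_insert]
      exact ⟨nofun, hΔ' _ _⟩
    · rintro ⟨χ, hχ⟩
      simp only [Finset.mem_insert, Prod.mk.injEq, reduceCtorEq, and_false, false_or] at hχ
      exact absurd hχ (hΔ χ)
  | succ n =>
    obtain ⟨a, v, hv, hn⟩ := hb
    refine ⟨⟨Γ, insert (.know a (.common φ), .foc) Δ⟩, ?_, n, w, ⟨h1, ?_, ?_⟩,
      fun _ => Nat.lt_succ_self n⟩
    · simp only [commonRPremises, List.mem_cons, List.mem_map, Finset.mem_toList, Finset.mem_univ,
        true_and]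
      exact .inr ⟨a, rfl⟩
    · simp only [Finset.forall_mem_insert]
      exact ⟨fun hs => M.not_sat_of_failsIn hn (hs v hv), h2.2⟩
    · simp only [Finset.forall_mem_insert]
      exact ⟨fun _ => ⟨v, hv, hn⟩, hΔ' _ _⟩

open scoped Classical in
-- Only `impR` and `ruleS5` change the world, and only `focus` may need a new budget.
theorem Refutes.exists_premise [Fintype A] [Nonempty A] {r : RuleName A} {σ : PreSequent A At}
    {l : List (PreSequent A At)} {n : ℕ} {w : W} (hr : Rule r σ l) (hP : Calculus.cICKS5.HasRule r)
    (hσf : ∀ φ, (φ, Ann.foc) ∈ σ.right → φ.Focusable)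
    (hlf : ∀ τ ∈ l, ∀ φ, (φ, Ann.foc) ∈ τ.right → φ.Focusable)
    (hlu : ∀ τ ∈ l, ∀ φ ψ, (φ, Ann.foc) ∈ τ.right → (ψ, Ann.foc) ∈ τ.right → φ = ψ)
    (hno : ∀ Γ Δ φ, r = .commonR → σ = ⟨Γ, insert (.common φ, .foc) Δ⟩ →
      l ≠ commonRPremises Γ Δ φ .foc)
    (h : M.Refutes n σ w) :
    ∃ τ ∈ l, ∃ m w', M.Refutes m τ w' ∧ ((∃ χ, (χ, Ann.foc) ∈ σ.right) → m ≤ n) := by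
  have same : (∃ τ ∈ l, M.Refutes n τ w) →
      ∃ τ ∈ l, ∃ m w', M.Refutes m τ w' ∧ ((∃ χ, (χ, Ann.foc) ∈ σ.right) → m ≤ n) :=
    fun ⟨τ, hτ, hw⟩ => ⟨τ, hτ, n, w, hw, fun _ => le_rfl⟩
  obtain ⟨h1, h2, h3⟩ := h
  cases hr with
  | ax Γ Δ φ b =>
    simp only [Finset.forall_mem_insert] at h1 h2
    exact absurd h1.1 h2.1
  | bot Γ Δ =>
    simp only [Finset.forall_mem_insert] at h1
    exact absurd h1.1 id
  | andL Γ Δ φ ψ =>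
    apply same
    simp only [Refutes, Finset.forall_mem_insert, Sat, List.mem_singleton, exists_eq_left] at *
    tauto
  | andR Γ Δ φ ψ =>
    apply same
    simp only [Refutes, Finset.forall_mem_insert, Sat, List.mem_cons, List.not_mem_nil, or_false,
      exists_eq_or_imp, exists_eq_left, reduceCtorEq, false_imp_iff, true_and] at *
    tauto
  | orL Γ Δ φ ψ =>
    apply same
    simp only [Refutes, Finset.forall_mem_insert, Sat, List.mem_cons, List.not_mem_nil, or_false,
      exists_eq_or_imp, exists_eq_left, reduceCtorEq, false_imp_iff] at *
    tauto
  | orR Γ Δ φ ψ =>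
    apply same
    simp only [Refutes, Finset.forall_mem_insert, Sat, List.mem_cons, List.not_mem_nil, or_false,
      exists_eq_left, reduceCtorEq, false_imp_iff, true_and] at *
    tauto
  | impL Γ Δ φ ψ =>
    apply same
    have h4 := fun h : M.Sat (.imp φ ψ) w => h w (M.le_refl w)
    simp only [Refutes, Finset.forall_mem_insert, List.mem_cons, List.not_mem_nil, or_false,
      exists_eq_or_imp, exists_eq_left, reduceCtorEq, false_imp_iff, true_and] at *
    tauto
  | impR Γ Δ φ ψ =>
    simp only [Finset.forall_mem_insert] at h2
    have h4 := h2.1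
    simp only [Sat, not_forall] at h4
    obtain ⟨v, hv, hφ, hψ⟩ := h4
    refine ⟨_, List.mem_cons_self, n, v, ⟨?_, ?_, ?_⟩, fun _ => le_rfl⟩
    · simp only [Finset.forall_mem_insert]
      exact ⟨hφ, fun x hx => (h1 x hx).mono hv⟩
    · simpa using hψ
    · simp
  | unfocus Γ Δ φ =>
    apply same
    simp only [Refutes, Finset.forall_mem_insert, List.mem_cons, List.not_mem_nil, or_false,
      exists_eq_left, reduceCtorEq, false_imp_iff, true_and] at *
    tauto
  | focus Γ Δ φ =>
    simp only [Finset.forall_mem_insert] at h2 h3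
    -- If the context already holds a focused formula, uniqueness in the premise identifies it with
    -- `φ` and its budget is kept. Otherwise the conclusion has no focus and any budget is
    -- admissible.
    have hb : ∃ m, M.Budget m w φ ∧ (∀ x ∈ Δ, x.2 = Ann.foc → M.Budget m w x.1) ∧
        ((∃ χ, (χ, Ann.foc) ∈ Δ) → m ≤ n) := by
      by_cases hΔ : ∃ χ, (χ, Ann.foc) ∈ Δ
      · obtain ⟨χ, hχ⟩ := hΔ
        have : χ = φ := hlu _ List.mem_cons_self χ φ (by simp [hχ]) (by simp)
        subst this
        exact ⟨n, h3.2 _ hχ rfl, h3.2, fun _ => le_rfl⟩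
      · obtain ⟨m, hm⟩ := M.exists_budget (hlf _ List.mem_cons_self φ (by simp)) h2.1
        refine ⟨m, hm, ?_, fun h => absurd h hΔ⟩
        rintro ⟨χ, b⟩ hx rfl
        exact absurd ⟨χ, hx⟩ hΔ
    obtain ⟨m, hm1, hm2, hm3⟩ := hb
    refine ⟨_, List.mem_cons_self, m, w, ⟨h1, ?_, ?_⟩, ?_⟩
    · simpa only [Finset.forall_mem_insert] using h2
    · simp only [Finset.forall_mem_insert]
      exact ⟨fun _ => hm1, hm2⟩
    · simpa using hm3
  | ruleK a => exact hP.elim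
  | ruleT a Γ Δ φ =>
    apply same
    have h4 := fun h : M.Sat (.know a φ) w => h w ((M.equivalence a).refl w)
    simp only [Refutes, Finset.forall_mem_insert, List.mem_singleton, exists_eq_left] at *
    tauto
  | ruleS4 a => exact hP.elim
  | ruleS5 a Γ Δ Ξ Θ φ b =>
    simp only [Finset.forall_mem_insert, Finset.forall_mem_union, knowSet,
      Finset.forall_mem_image] at h1 h2 h3
    -- In the focused case the successor must be the one given by the budget, not just any world
    -- violating `φ`.
    have hb : ∃ v, M.rel a w v ∧ ¬ M.Sat φ v ∧ (b = .foc → M.Budget n v φ) := by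
      cases b with
      | unfoc =>
        have h4 := h2.1
        simp only [Sat, not_forall] at h4
        obtain ⟨v, hv, hφ⟩ := h4
        exact ⟨v, hv, hφ, nofun⟩
      | foc =>
        have h4 := h3.1 rfl
        obtain ⟨ψ, hψ⟩ | ⟨c, ψ, hψ⟩ := hσf (.know a φ) (by simp)
        · cases hψ
        · cases hψ
          obtain ⟨v, hv, hn⟩ := h4
          exact ⟨v, hv, M.not_sat_of_failsIn hn, fun _ => hn⟩
    obtain ⟨v, hv, hφ, hn⟩ := hb
    refine ⟨_, List.mem_cons_self, n, v, ⟨?_, ?_, ?_⟩, fun _ => le_rfl⟩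
    · simp only [knowSet, Finset.forall_mem_image]
      exact fun x hx => (M.sat_know_iff_of_rel hv).1 (h1.2 hx)
    · simp only [knowSet, Finset.forall_mem_image, Finset.forall_mem_insert]
      exact ⟨hφ, fun x hx hs => h2.2.1 hx ((M.sat_know_iff_of_rel hv).2 hs)⟩
    · simp only [knowSet, Finset.forall_mem_image, Finset.forall_mem_insert]
      refine ⟨hn, ?_⟩
      -- A focused formula of the context has the form `K_a C ψ`; its witness is also related to
      -- `v`, by symmetry and transitivity.
      rintro ⟨χ, c⟩ hx rfl
      have h4 := h3.2.1 hx rfl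
      obtain ⟨ψ, hψ⟩ | ⟨c, ψ, hψ⟩ := hσf (.know a χ) (by
        simp only [Finset.mem_insert, Finset.mem_union, knowSet, Finset.mem_image]
        exact .inr (.inl ⟨_, hx, rfl⟩))
      · cases hψ
      · cases hψ
        obtain ⟨u, hu, hnu⟩ := h4
        exact ⟨u, (M.equivalence a).trans ((M.equivalence a).symm hv) hu, hnu⟩
  | knowImp a Γ Δ φ ψ =>
    apply same
    have h4 : ¬ M.Sat (.imp (.know a φ) ψ) w → M.Sat (.know a φ) w ∧ ¬ M.Sat ψ w := by
      intro h
      simp only [Sat, not_forall] at h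
      obtain ⟨v, hv, hφ, hψ⟩ := h
      exact ⟨(M.sat_know_iff_of_rel (M.rel_of_le a w v hv)).2 hφ, fun hs => hψ (hs.mono hv)⟩
    simp only [Refutes, Finset.forall_mem_insert, List.mem_singleton, exists_eq_left, reduceCtorEq,
      false_imp_iff, true_and] at *
    tauto
  | commonL Γ Δ φ =>
    apply same
    have h4 := M.sat_common_iff (φ := φ) (w := w)
    simp only [Refutes, Finset.forall_mem_insert, List.mem_singleton, exists_eq_left,
      Finset.forall_mem_union, Finset.forall_mem_image, Finset.mem_univ, forall_true_left] at *
    tauto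
  | commonR Γ Δ φ b =>
    apply same
    cases b with
    | foc => exact absurd rfl (hno Γ Δ φ rfl rfl)
    | unfoc =>
      simp only [Finset.forall_mem_insert, reduceCtorEq, false_imp_iff, true_and] at h2 h3
      have h4 := h2.1
      rw [M.sat_common_iff, not_and_or, not_forall] at h4
      rcases h4 with h4 | ⟨a, h4⟩
      · refine ⟨_, List.mem_cons_self, h1, ?_, ?_⟩
        · simp only [Finset.forall_mem_insert]
          exact ⟨h4, h2.2⟩
        · simp only [Finset.forall_mem_insert]
          exact ⟨nofun, h3⟩
      · refine ⟨⟨Γ, insert (.know a (.common φ), .unfoc) Δ⟩, ?_, h1, ?_, ?_⟩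
        · simp only [commonRPremises, List.mem_cons, List.mem_map, Finset.mem_toList,
            Finset.mem_univ, true_and]
          exact .inr ⟨a, rfl⟩
        · simp only [Finset.forall_mem_insert]
          exact ⟨h4, h2.2⟩
        · simp only [Finset.forall_mem_insert]
          exact ⟨nofun, h3⟩
  | cut Γ Δ φ =>
    apply same
    simp only [Refutes, Finset.forall_mem_insert, List.mem_cons, List.not_mem_nil, or_false,
      exists_eq_or_imp, exists_eq_left, reduceCtorEq, false_imp_iff, true_and] at *
    tauto

/-- Soundness of cyclic proofs. -/
theorem not_refutes_of_provable [Fintype A] [Nonempty A] {σ : Sequent A At}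
    (h : Provable .cICKS5 σ) (n : ℕ) (w : W) : ¬ M.Refutes n σ.toPreSequent w := by
  classical
  obtain ⟨π, hπ⟩ := h
  have hcor := hπ.correct (Q := fun i => i.IsInstance .cICKS5)
    fun p i child hp => (hπ.preProof p i child hp).1
  intro hw
  refine hcor.not_refuted (D := fun n τ => ∃ w, M.Refutes n τ.toPreSequent w) ?_ n
    ⟨w, by rwa [hπ.root]⟩
  rintro ⟨c, r, l⟩ ⟨hP, hr⟩ n ⟨w, hw⟩
  by_cases hC : (⟨c, r, l⟩ : RuleTriple A At).IsFocusedCommonR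
  · obtain ⟨-, Γ, Δ, φ, hc, hl⟩ := hC
    simp only at hc hl hw
    -- The context could only repeat the focused `C φ`; but then a premise would have both `C φ` and
    -- `K_a C φ` in focus.
    have hΔ : ∀ ψ, (ψ, Ann.foc) ∉ Δ := by
      intro ψ hψ
      have h1 : ψ = .common φ := c.focus_unique _ _ (by rw [hc]; simp [hψ]) (by rw [hc]; simp)
      let a := Classical.arbitrary A
      have h2 : (⟨Γ, insert (.know a (.common φ), .foc) Δ⟩ : PreSequent A At) ∈
          l.map Sequent.toPreSequent := by
        rw [hl]
        simp [commonRPremises]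
      obtain ⟨τ, -, hτ⟩ := List.mem_map.1 h2
      have h3 : ψ = .know a (.common φ) :=
        τ.focus_unique _ _ (by rw [hτ]; simp [hψ]) (by rw [hτ]; simp)
      rw [h1] at h3
      cases h3
    rw [hc] at hw
    obtain ⟨τ, hτ, m, w', hw', hm⟩ := hw.exists_premise_of_focused hΔ
    rw [← hl] at hτ
    obtain ⟨τ, hτl, rfl⟩ := List.mem_map.1 hτ
    exact ⟨τ, hτl, m, ⟨w', hw'⟩, fun _ hf => ⟨(hm hf).le, fun _ => hm hf⟩⟩
  · have hmem : ∀ τ ∈ l.map Sequent.toPreSequent, ∃ τ' ∈ l, τ'.toPreSequent = τ :=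
      fun τ hτ => List.mem_map.1 hτ
    obtain ⟨τ, hτ, m, w', hw', hm⟩ := hw.exists_premise hr hP c.focusable
      (fun τ hτ => by obtain ⟨τ, -, rfl⟩ := hmem τ hτ; exact τ.focusable)
      (fun τ hτ => by obtain ⟨τ, -, rfl⟩ := hmem τ hτ; exact τ.focus_unique)
      (fun Γ Δ φ h1 h2 h3 => hC ⟨h1, Γ, Δ, φ, h2, h3⟩)
    obtain ⟨τ, hτl, rfl⟩ := hmem τ hτ
    exact ⟨τ, hτl, m, ⟨w', hw'⟩, fun hf _ => ⟨hm hf, fun h => absurd h hC⟩⟩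

end Model
end ICK

/-! ### Closure of the fixpoints under rules; unfocused sequents and cuts on `S` -/

namespace ICK

variable {A At : Type*}

/-- The pair `σ` is an `S`-sequent that belongs to `X`. -/
def Holds {S : Finset (Formula A At)} (X : Set (SequentOver S)) (σ : PreSequent A At) : Prop :=
  ∃ τ ∈ X, τ.1.toPreSequent = σ

theorem holds_iff_mem {S : Finset (Formula A At)} {X : Set (SequentOver S)} {τ : SequentOver S} :
    Holds X τ.1.toPreSequent ↔ τ ∈ X := by
  constructor
  · rintro ⟨τ', hτ', h⟩
    rwa [← Subtype.ext (Sequent.toPreSequent_injective h)]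
  · exact fun h => ⟨τ, h, rfl⟩

theorem Holds.mono {S : Finset (Formula A At)} {X Y : Set (SequentOver S)} (h : X ⊆ Y)
    {σ : PreSequent A At} (hσ : Holds X σ) : Holds Y σ :=
  hσ.imp fun _ hτ => ⟨h hτ.1, hτ.2⟩

section RuleClosure

variable [Fintype A] {P : Calculus} {S : Finset (Formula A At)}

/-- Rules speak about bare pairs while moves are triples of sequents; this lemma assembles the
triple. -/
theorem mem_stepSet {X Y Z : Set (SequentOver S)} {τ : SequentOver S} {r : RuleName A}
    {l : List (PreSequent A At)} (hP : P.HasRule r) (hr : Rule r τ.1.toPreSequent l)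
    (hl : ∀ σ ∈ l, ∃ τ' : SequentOver S, τ'.1.toPreSequent = σ)
    (h : ∀ i : RuleTriple A At, i.conclusion = τ.1 → i.rule = r →
      i.premises.map Sequent.toPreSequent = l → ∀ σ ∈ l, (¬ τ.1.HasFocus → Holds Z σ) ∧
        (τ.1.HasFocus → i.IsFocusedCommonR → Holds Y σ) ∧
        (τ.1.HasFocus → ¬ i.IsFocusedCommonR → Holds X σ)) :
    τ ∈ stepSet P S X Y Z := by
  have hlift : ∃ l' : List (SequentOver S), l'.map (fun τ => τ.1.toPreSequent) = l := by
    clear hr h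
    induction l with
    | nil => exact ⟨[], rfl⟩
    | cons σ l ih =>
      obtain ⟨l', rfl⟩ := ih fun σ' hσ' => hl σ' (List.mem_cons_of_mem _ hσ')
      obtain ⟨τ', rfl⟩ := hl σ List.mem_cons_self
      exact ⟨τ' :: l', rfl⟩
  obtain ⟨l', hl'⟩ := hlift
  have hmap : (l'.map Subtype.val).map Sequent.toPreSequent = l := by
    rw [← hl', List.map_map]
    rfl
  refine ⟨⟨⟨τ.1, r, l'.map Subtype.val⟩, ⟨hP, by rw [hmap]; exact hr⟩, τ.2, ?_⟩, rfl, ?_⟩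
  · intro τ' hτ'
    obtain ⟨τ'', -, rfl⟩ := List.mem_map.1 hτ'
    exact τ''.2
  · intro τ' hτ'
    obtain ⟨h1, h2, h3⟩ := h ⟨τ.1, r, l'.map Subtype.val⟩ rfl rfl hmap τ'.1.toPreSequent
      (by rw [← hmap]; exact List.mem_map_of_mem hτ')
    exact ⟨fun hf => holds_iff_mem.1 (h1 hf), fun hf hC => holds_iff_mem.1 (h2 hf hC),
      fun hf hC => holds_iff_mem.1 (h3 hf hC)⟩

/-- The winning region is a fixed point of `stepSet` with all three arguments equal, so focus and
priority play no role. -/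
theorem Holds.winSet_of_rule {σ : PreSequent A At} {r : RuleName A} {l : List (PreSequent A At)}
    (hP : P.HasRule r) (hr : Rule r σ l) (hσ : ∃ τ : SequentOver S, τ.1.toPreSequent = σ)
    (hl : ∀ σ ∈ l, Holds (winSet P S) σ) : Holds (winSet P S) σ := by
  obtain ⟨τ, rfl⟩ := hσ
  rw [holds_iff_mem, ← stepSet_winSet]
  exact mem_stepSet hP hr (fun σ hσ => (hl σ hσ).imp fun _ h => h.2) fun i _ _ _ σ hσ =>
    ⟨fun _ => hl σ hσ, fun _ _ => hl σ hσ, fun _ _ => hl σ hσ⟩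

theorem Holds.reachSet_of_rule {Y Z : Set (SequentOver S)} {σ : PreSequent A At} {r : RuleName A}
    {l : List (PreSequent A At)} (hP : P.HasRule r) (hr : Rule r σ l) (hne : r ≠ .commonR)
    (hσ : ∃ τ : SequentOver S, τ.1.toPreSequent = σ) (hf : ∃ φ, (φ, Ann.foc) ∈ σ.right)
    (hl : ∀ σ ∈ l, Holds (reachSet P S Y Z) σ) : Holds (reachSet P S Y Z) σ := by
  obtain ⟨τ, rfl⟩ := hσ
  rw [holds_iff_mem, ← stepSet_reachSet]
  exact mem_stepSet hP hr (fun σ hσ => (hl σ hσ).imp fun _ h => h.2) fun i _ hi _ σ hσ =>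
    ⟨fun h => absurd hf h, fun _ hC => absurd (hi.symm.trans hC.1) hne, fun _ _ => hl σ hσ⟩

open scoped Classical in
-- The focused unfolding is the one move whose premises need only lie in `Y`: this is where a
-- coinductive hypothesis may be used.
theorem Holds.reachSet_of_commonR {Y Z : Set (SequentOver S)} {Γ Δ : Finset (AFormula A At)}
    {φ : Formula A At} (hP : P.HasRule (.commonR : RuleName A))
    (hσ : ∃ τ : SequentOver S, τ.1.toPreSequent = ⟨Γ, insert (.common φ, .foc) Δ⟩)
    (hl : ∀ σ ∈ commonRPremises Γ Δ φ .foc, Holds Y σ) :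
    Holds (reachSet P S Y Z) ⟨Γ, insert (.common φ, .foc) Δ⟩ := by
  have hr := Rule.commonR Γ Δ φ .foc
  obtain ⟨τ, hτ⟩ := hσ
  rw [← hτ] at hr ⊢
  rw [holds_iff_mem, ← stepSet_reachSet]
  refine mem_stepSet hP hr (fun σ hσ => (hl σ hσ).imp fun _ h => h.2) fun i hc hi hm σ hσ =>
    ⟨fun h => absurd ⟨.common φ, by rw [hτ]; simp⟩ h, fun _ _ => hl σ hσ,
      fun _ hC => absurd ⟨hi, Γ, Δ, φ, by rw [hc, hτ], hm⟩ hC⟩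

end RuleClosure

section PlainSequents

open scoped Classical in
/-- The formulae of a finite set, unfocused. -/
noncomputable def unfocused (Γ : Finset (Formula A At)) : Finset (AFormula A At) :=
  Γ.image fun φ => (φ, .unfoc)

@[simp] theorem mem_unfocused {Γ : Finset (Formula A At)} {φ : Formula A At} {b : Ann} :
    (φ, b) ∈ unfocused Γ ↔ φ ∈ Γ ∧ b = .unfoc := by
  simp [unfocused, eq_comm]

open scoped Classical in
theorem unfocused_insert (Γ : Finset (Formula A At)) (φ : Formula A At) :
    unfocused (insert φ Γ) = insert (φ, .unfoc) (unfocused Γ) := by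
  ext ⟨ψ, b⟩
  simp only [mem_unfocused, Finset.mem_insert, Prod.mk.injEq]
  tauto

/-- The sequent `Γ ⇒ Δ` without focus. -/
noncomputable def plain (Γ Δ : Finset (Formula A At)) : PreSequent A At :=
  ⟨unfocused Γ, unfocused Δ⟩

open scoped Classical in
/-- The sequent `Γ ⇒ χ, Δ` with `χ` in focus. -/
noncomputable def focusedOn (χ : Formula A At) (Γ Δ : Finset (Formula A At)) : PreSequent A At :=
  ⟨unfocused Γ, insert (χ, .foc) (unfocused Δ)⟩

variable {S Γ Δ : Finset (Formula A At)}

theorem exists_plain (hΓ : Γ ⊆ S) (hΔ : Δ ⊆ S) :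
    ∃ τ : SequentOver S, τ.1.toPreSequent = plain Γ Δ := by
  refine ⟨⟨⟨plain Γ Δ, ?_, ?_, ?_⟩, ?_⟩, rfl⟩
  · simp [plain]
  · simp [plain]
  · simp [plain]
  · rintro φ b (h | h)
    · exact hΓ (mem_unfocused.1 h).1
    · exact hΔ (mem_unfocused.1 h).1

theorem exists_focusedOn {χ : Formula A At} (hχ : χ.Focusable) (hχS : χ ∈ S) (hΓ : Γ ⊆ S)
    (hΔ : Δ ⊆ S) : ∃ τ : SequentOver S, τ.1.toPreSequent = focusedOn χ Γ Δ := by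
  refine ⟨⟨⟨focusedOn χ Γ Δ, ?_, ?_, ?_⟩, ?_⟩, rfl⟩
  · simp [focusedOn]
  · simp +contextual [focusedOn]
  · simp [focusedOn, hχ]
  · rintro φ b (h | h)
    · exact hΓ (mem_unfocused.1 h).1
    · simp only [focusedOn, Finset.mem_insert, Prod.mk.injEq, mem_unfocused] at h
      rcases h with ⟨rfl, -⟩ | h
      · exact hχS
      · exact hΔ h.1

open scoped Classical in
/-- A property of pairs of subsets of `S` that is closed under cut holds if it holds for all
extensions that exhaust `S`. -/
theorem cut_induction {Q : Finset (Formula A At) → Finset (Formula A At) → Prop}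
    (hcut : ∀ Γ Δ φ, Γ ⊆ S → Δ ⊆ S → φ ∈ S → Q (insert φ Γ) Δ → Q Γ (insert φ Δ) → Q Γ Δ)
    (hΓ : Γ ⊆ S) (hΔ : Δ ⊆ S)
    (hmax : ∀ Γ' Δ', Γ ⊆ Γ' → Δ ⊆ Δ' → Γ' ⊆ S → Δ' ⊆ S → S ⊆ Γ' ∪ Δ' → Q Γ' Δ') : Q Γ Δ := by
  -- Each cut decides one more formula of `S`.
  induction hn : (S \ (Γ ∪ Δ)).card using Nat.strong_induction_on generalizing Γ Δ with
  | _ n ih =>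
  subst hn
  by_cases hS : S ⊆ Γ ∪ Δ
  · exact hmax Γ Δ subset_rfl subset_rfl hΓ hΔ hS
  · obtain ⟨φ, hφ, hφ'⟩ := Finset.not_subset.1 hS
    have hlt : (S \ insert φ (Γ ∪ Δ)).card < (S \ (Γ ∪ Δ)).card := by
      refine Finset.card_lt_card (Finset.ssubset_iff_of_subset
        (Finset.sdiff_subset_sdiff subset_rfl (Finset.subset_insert _ _)) |>.2 ⟨φ, ?_, ?_⟩)
      · exact Finset.mem_sdiff.2 ⟨hφ, hφ'⟩
      · simp
    refine hcut Γ Δ φ hΓ hΔ hφ (ih _ ?_ (Finset.insert_subset hφ hΓ) hΔ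
      (fun Γ' Δ' h => hmax Γ' Δ' ((Finset.subset_insert _ _).trans h)) rfl)
      (ih _ ?_ hΓ (Finset.insert_subset hφ hΔ)
      (fun Γ' Δ' h h' => hmax Γ' Δ' h ((Finset.subset_insert _ _).trans h')) rfl)
    · rwa [Finset.insert_union]
    · rwa [Finset.union_insert]

end PlainSequents
end ICK

/-! ### Worlds of the canonical model -/

namespace ICK

variable {A At : Type*} [Fintype A]

section Canonical

variable {S : Finset (Formula A At)}

theorem holds_plain_of_mem {P : Calculus} {Γ Δ : Finset (Formula A At)} {φ : Formula A At}
    (hP : P.HasRule (.ax : RuleName A)) (hΓ : Γ ⊆ S) (hΔ : Δ ⊆ S) (h₁ : φ ∈ Γ) (h₂ : φ ∈ Δ) :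
    Holds (winSet P S) (plain Γ Δ) := by
  classical
  have hr := Rule.ax (unfocused Γ) (unfocused Δ) φ .unfoc
  rw [Finset.insert_eq_of_mem (by simpa), Finset.insert_eq_of_mem (by simpa)] at hr
  exact Holds.winSet_of_rule hP hr (exists_plain hΓ hΔ) (by simp)

variable (S) in
open scoped Classical in
/-- The worlds of the canonical model: subsets of `S` that are not refutable. -/
def World : Type _ :=
  {Γ : Finset (Formula A At) // Γ ⊆ S ∧ ¬ Holds (winSet .cICKS5 S) (plain Γ (S \ Γ))}

open scoped Classical in
-- A Lindenbaum argument by cuts. Exhaustive extensions that overlap are axioms; the others are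
-- complementary in `S`, hence worlds unless winning. With no separating world all are winning, and
-- so is the original pair.
theorem exists_world {Γ Δ : Finset (Formula A At)} (hΓ : Γ ⊆ S) (hΔ : Δ ⊆ S)
    (h : ¬ Holds (winSet .cICKS5 S) (plain Γ Δ)) :
    ∃ w : World S, Γ ⊆ w.1 ∧ ∀ φ ∈ Δ, φ ∉ w.1 := by
  by_contra! hno
  refine h (cut_induction (Q := fun Γ Δ => Holds (winSet .cICKS5 S) (plain Γ Δ)) ?_ hΓ hΔ ?_)
  · intro Γ Δ φ hΓ hΔ hφ h₁ h₂
    refine Holds.winSet_of_rule (r := .cut) trivial (Rule.cut _ _ φ) (exists_plain hΓ hΔ) ?_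
    rw [plain, unfocused_insert] at h₁ h₂
    simp only [List.forall_mem_cons, List.not_mem_nil, false_imp_iff, implies_true, and_true]
    exact ⟨h₁, h₂⟩
  · intro Γ' Δ' h₁ h₂ hΓ' hΔ' hS
    by_cases hdis : ∃ φ ∈ Γ', φ ∈ Δ'
    · obtain ⟨φ, hφ, hφ'⟩ := hdis
      exact holds_plain_of_mem trivial hΓ' hΔ' hφ hφ'
    · push Not at hdis
      have hΔeq : Δ' = S \ Γ' := by
        ext φ
        rw [Finset.mem_sdiff]
        refine ⟨fun h => ⟨hΔ' h, fun h' => hdis φ h' h⟩, fun h => ?_⟩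
        exact (Finset.mem_union.1 (hS h.1)).resolve_left h.2
      rw [hΔeq]
      by_contra hh
      obtain ⟨φ, hφ, hφ'⟩ := hno ⟨Γ', hΓ', hh⟩ h₁
      exact hdis φ hφ' (h₂ hφ)

namespace World

variable (w : World S)

open scoped Classical in
theorem exists_premise {r : RuleName A} {l : List (PreSequent A At)}
    (hP : Calculus.cICKS5.HasRule r) (hr : Rule r (plain w.1 (S \ w.1)) l) :
    ∃ σ ∈ l, ¬ Holds (winSet .cICKS5 S) σ := by
  by_contra! hl
  exact w.2.2 (Holds.winSet_of_rule hP hr (exists_plain w.2.1 Finset.sdiff_subset) hl)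

open scoped Classical in
theorem mem_of_not_holds {Γ : Finset (Formula A At)} {φ : Formula A At} (hφ : φ ∈ S)
    (hΓ : Γ ⊆ S) (h : ¬ Holds (winSet .cICKS5 S) (plain Γ (S \ w.1))) (hφΓ : φ ∈ Γ) :
    φ ∈ w.1 := by
  by_contra hw
  exact h (holds_plain_of_mem trivial hΓ Finset.sdiff_subset hφΓ (Finset.mem_sdiff.2 ⟨hφ, hw⟩))

open scoped Classical in
theorem notMem_of_not_holds {Δ : Finset (Formula A At)} {φ : Formula A At}
    (hΔ : Δ ⊆ S) (h : ¬ Holds (winSet .cICKS5 S) (plain w.1 Δ)) (hφΔ : φ ∈ Δ) :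
    φ ∉ w.1 :=
  fun hw => h (holds_plain_of_mem trivial w.2.1 hΔ hw hφΔ)

open scoped Classical in
-- Commas are unions, so a principal formula already present is absorbed by the context and the rule
-- concludes the sequent of the world itself.
theorem left_rule {r : RuleName A} {l : List (PreSequent A At)} {χ : Formula A At}
    (hP : Calculus.cICKS5.HasRule r)
    (hr : Rule r ⟨insert (χ, .unfoc) (unfocused w.1), unfocused (S \ w.1)⟩ l) (hχ : χ ∈ w.1) :
    ∃ σ ∈ l, ¬ Holds (winSet .cICKS5 S) σ := by
  rw [Finset.insert_eq_of_mem (by simpa)] at hr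
  exact w.exists_premise hP hr

open scoped Classical in
theorem right_rule {r : RuleName A} {l : List (PreSequent A At)} {χ : Formula A At}
    (hP : Calculus.cICKS5.HasRule r)
    (hr : Rule r ⟨unfocused w.1, insert (χ, .unfoc) (unfocused (S \ w.1))⟩ l) (hχS : χ ∈ S)
    (hχ : χ ∉ w.1) : ∃ σ ∈ l, ¬ Holds (winSet .cICKS5 S) σ := by
  rw [Finset.insert_eq_of_mem (by simp [hχ, hχS])] at hr
  exact w.exists_premise hP hr

theorem bot_notMem : Formula.bot ∉ w.1 := by
  classical
  intro h
  obtain ⟨σ, hσ, -⟩ := w.left_rule (r := .bot) trivial (Rule.bot _ _) h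
  simp at hσ

variable (hS : IsNegClosedSet (S : Set (Formula A At)))
include hS

theorem and_mem_iff {φ ψ : Formula A At} (h : Formula.and φ ψ ∈ S) :
    Formula.and φ ψ ∈ w.1 ↔ φ ∈ w.1 ∧ ψ ∈ w.1 := by
  classical
  obtain ⟨hφ, hψ⟩ := hS.and_mem _ _ h
  constructor
  · intro hw
    have := w.left_rule (r := .andL) trivial (Rule.andL _ _ φ ψ) hw
    simp only [← unfocused_insert, List.mem_singleton, exists_eq_left] at this
    have hsub : insert φ (insert ψ w.1) ⊆ S :=
      Finset.insert_subset hφ (Finset.insert_subset hψ w.2.1)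
    exact ⟨w.mem_of_not_holds hφ hsub this (by simp), w.mem_of_not_holds hψ hsub this (by simp)⟩
  · rintro ⟨h₁, h₂⟩
    by_contra hw
    have := w.right_rule (r := .andR) trivial (Rule.andR _ _ φ ψ) h hw
    simp only [← unfocused_insert, List.mem_cons, List.not_mem_nil, or_false, exists_eq_or_imp,
      exists_eq_left] at this
    rcases this with this | this
    · exact w.notMem_of_not_holds (Finset.insert_subset hφ Finset.sdiff_subset) this
        (Finset.mem_insert_self _ _) h₁
    · exact w.notMem_of_not_holds (Finset.insert_subset hψ Finset.sdiff_subset) this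
        (Finset.mem_insert_self _ _) h₂

theorem or_mem_iff {φ ψ : Formula A At} (h : Formula.or φ ψ ∈ S) :
    Formula.or φ ψ ∈ w.1 ↔ φ ∈ w.1 ∨ ψ ∈ w.1 := by
  classical
  obtain ⟨hφ, hψ⟩ := hS.or_mem _ _ h
  constructor
  · intro hw
    have := w.left_rule (r := .orL) trivial (Rule.orL _ _ φ ψ) hw
    simp only [← unfocused_insert, List.mem_cons, List.not_mem_nil, or_false, exists_eq_or_imp,
      exists_eq_left] at this
    refine this.imp (fun h => ?_) (fun h => ?_)
    · exact w.mem_of_not_holds hφ (Finset.insert_subset hφ w.2.1) h (Finset.mem_insert_self _ _)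
    · exact w.mem_of_not_holds hψ (Finset.insert_subset hψ w.2.1) h (Finset.mem_insert_self _ _)
  · intro hor
    by_contra hw
    have := w.right_rule (r := .orR) trivial (Rule.orR _ _ φ ψ) h hw
    simp only [← unfocused_insert, List.mem_singleton, exists_eq_left] at this
    have hsub : insert φ (insert ψ (S \ w.1)) ⊆ S :=
      Finset.insert_subset hφ (Finset.insert_subset hψ Finset.sdiff_subset)
    exact hor.elim (w.notMem_of_not_holds hsub this (by simp))
      (w.notMem_of_not_holds hsub this (by simp))

theorem mem_of_imp_mem {φ ψ : Formula A At} (h : Formula.imp φ ψ ∈ w.1) (hφw : φ ∈ w.1) :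
    ψ ∈ w.1 := by
  classical
  obtain ⟨hφ, hψ⟩ := hS.imp_mem _ _ (w.2.1 h)
  have := w.left_rule (r := .impL) trivial (Rule.impL _ _ φ ψ) h
  simp only [← unfocused_insert, List.mem_cons, List.not_mem_nil, or_false, exists_eq_or_imp,
    exists_eq_left] at this
  rcases this with this | this
  · exact absurd hφw (w.notMem_of_not_holds (Finset.insert_subset hφ Finset.sdiff_subset) this
        (Finset.mem_insert_self _ _))
  · exact w.mem_of_not_holds hψ (Finset.insert_subset hψ w.2.1) this (Finset.mem_insert_self _ _)

theorem exists_of_imp_notMem {φ ψ : Formula A At} (h : Formula.imp φ ψ ∈ S)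
    (hw : Formula.imp φ ψ ∉ w.1) : ∃ v : World S, w.1 ⊆ v.1 ∧ φ ∈ v.1 ∧ ψ ∉ v.1 := by
  classical
  obtain ⟨hφ, hψ⟩ := hS.imp_mem _ _ h
  have := w.right_rule (r := .impR) trivial (Rule.impR _ _ φ ψ) h hw
  have hsing : ({(ψ, .unfoc)} : Finset (AFormula A At)) = unfocused {ψ} := by
    ext ⟨χ, b⟩
    simp
  simp only [← unfocused_insert, List.mem_singleton, exists_eq_left, hsing] at this
  obtain ⟨v, hv, hv'⟩ := exists_world (Finset.insert_subset hφ w.2.1) (by simpa using hψ) this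
  exact ⟨v, (Finset.subset_insert _ _).trans hv, hv (Finset.mem_insert_self _ _),
    hv' ψ (Finset.mem_singleton_self _)⟩

/-- This is where negation closure and `knowImp` enter. If `w` omits `K_a φ`, then it contains `¬
K_a φ`, which persists to `v` and contradicts `K_a φ` there. It makes the order part of every
accessibility relation. -/
theorem know_mem_of_subset {v : World S} (hwv : w.1 ⊆ v.1) {a : A} {φ : Formula A At}
    (h : Formula.know a φ ∈ v.1) : Formula.know a φ ∈ w.1 := by
  classical
  by_contra hw
  have hK := v.2.1 h
  have hN := hS.neg_know_mem a φ hK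
  have hneg : (Formula.know a φ).neg ∈ w.1 := by
    by_contra hw'
    have := w.right_rule (r := .knowImp a) trivial (Rule.knowImp a _ _ φ .bot) hN hw'
    simp only [← unfocused_insert, List.mem_singleton, exists_eq_left] at this
    refine this (holds_plain_of_mem trivial (Finset.insert_subset hK w.2.1)
      (Finset.insert_subset (hS.imp_mem _ _ hN).2 Finset.sdiff_subset)
      (Finset.mem_insert_self _ _) (Finset.mem_insert_of_mem (Finset.mem_sdiff.2 ⟨hK, hw⟩)))
  exact v.bot_notMem (v.mem_of_imp_mem hS (hwv hneg) h)

theorem mem_of_know_mem {a : A} {φ : Formula A At} (h : Formula.know a φ ∈ w.1) : φ ∈ w.1 := by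
  classical
  have hφ := hS.know_mem _ _ (w.2.1 h)
  have := w.left_rule (r := .ruleT a) trivial (Rule.ruleT a _ _ φ) h
  simp only [← unfocused_insert, List.mem_singleton, exists_eq_left] at this
  exact w.mem_of_not_holds hφ (Finset.insert_subset hφ w.2.1) this (Finset.mem_insert_self _ _)

theorem mem_of_common_mem {φ : Formula A At} (h : Formula.common φ ∈ w.1) :
    φ ∈ w.1 ∧ ∀ a, Formula.know a (.common φ) ∈ w.1 := by
  classical
  obtain ⟨hφ, hK⟩ := hS.common_mem _ (w.2.1 h)
  have := w.left_rule (r := .commonL) trivial (Rule.commonL _ _ φ) h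
  have heq : (Finset.univ.image fun a : A => (Formula.know a (.common φ), Ann.unfoc)) ∪
      unfocused w.1 =
      unfocused (Finset.univ.image (fun a : A => Formula.know a (.common φ)) ∪ w.1) := by
    ext ⟨χ, b⟩
    simp only [Finset.mem_union, Finset.mem_image, Finset.mem_univ, true_and, mem_unfocused,
      Prod.mk.injEq, exists_and_right]
    tauto
  simp only [List.mem_singleton, exists_eq_left, heq, ← unfocused_insert] at this
  have hsub : insert φ (Finset.univ.image (fun a : A => Formula.know a (.common φ)) ∪ w.1) ⊆ S := by
    refine Finset.insert_subset hφ (Finset.union_subset ?_ w.2.1)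
    intro χ hχ
    obtain ⟨a, -, rfl⟩ := Finset.mem_image.1 hχ
    exact hK a
  exact ⟨w.mem_of_not_holds hφ hsub this (by simp),
    fun a => w.mem_of_not_holds (hK a) hsub this (by simp)⟩

/-- The two worlds contain the same formulae `K_a φ`. -/
def Rel (a : A) (w v : World S) : Prop :=
  ∀ φ, Formula.know a φ ∈ w.1 ↔ Formula.know a φ ∈ v.1

end World
end Canonical
end ICK

/-! ### Canonical accessibility, truth lemma and completeness -/

namespace ICK

variable {A At : Type*}

open scoped Classical in
/-- The formulae `K_a φ` in `Γ`. -/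
noncomputable def knowPart (a : A) (Γ : Finset (Formula A At)) :
    Finset (Formula A At) :=
  Γ.filter fun χ => ∃ φ, χ = .know a φ

@[simp] theorem mem_knowPart {a : A} {Γ : Finset (Formula A At)} {χ : Formula A At} :
    χ ∈ knowPart a Γ ↔ χ ∈ Γ ∧ ∃ φ, χ = .know a φ := by
  simp [knowPart]

open scoped Classical in
theorem exists_knowSet_eq {S : Finset (Formula A At)}
    (hS : IsNegClosedSet (S : Set (Formula A At))) {Γ : Finset (Formula A At)} (hΓ : Γ ⊆ S)
    (a : A) : ∃ Γ' : Finset (AFormula A At), knowSet a Γ' = unfocused (knowPart a Γ) := by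
  refine ⟨unfocused (S.filter fun φ => Formula.know a φ ∈ Γ), ?_⟩
  ext ⟨χ, b⟩
  simp only [knowSet, Finset.mem_image, mem_unfocused, mem_knowPart, Prod.exists, Prod.mk.injEq,
    Finset.mem_filter]
  constructor
  · rintro ⟨φ, c, ⟨⟨-, h⟩, rfl⟩, rfl, rfl⟩
    exact ⟨⟨h, φ, rfl⟩, rfl⟩
  · rintro ⟨⟨h, φ, rfl⟩, rfl⟩
    exact ⟨φ, .unfoc, ⟨⟨hS.know_mem a φ (hΓ h), h⟩, rfl⟩, rfl, rfl⟩

namespace World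

variable [Fintype A] {S : Finset (Formula A At)} (w : World S)

open scoped Classical in
theorem rel_of_knowPart_subset {a : A} {v : World S} (h₁ : knowPart a w.1 ⊆ v.1)
    (h₂ : ∀ χ ∈ knowPart a (S \ w.1), χ ∉ v.1) : w.Rel a v := by
  intro φ
  refine ⟨fun h => h₁ (mem_knowPart.2 ⟨h, φ, rfl⟩), fun h => ?_⟩
  by_contra hw
  exact h₂ _ (mem_knowPart.2 ⟨Finset.mem_sdiff.2 ⟨v.2.1 h, hw⟩, φ, rfl⟩) h

variable (hS : IsNegClosedSet (S : Set (Formula A At)))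
include hS

open scoped Classical in
-- The instance keeps every `K_a`-formula on both sides, so each world extending the premise is
-- related to `w`.
theorem rule_S5 (a : A) (φ : Formula A At) (b : Ann) :
    Rule (.ruleS5 a) ⟨unfocused w.1, insert (.know a φ, b) (unfocused (S \ w.1))⟩
      [⟨unfocused (knowPart a w.1), insert (φ, b) (unfocused (knowPart a (S \ w.1)))⟩] := by
  obtain ⟨Γ, hΓ⟩ := exists_knowSet_eq hS w.2.1 a
  obtain ⟨Δ, hΔ⟩ := exists_knowSet_eq hS (Finset.sdiff_subset : S \ w.1 ⊆ S) a
  have hr := Rule.ruleS5 a Γ Δ (unfocused w.1) (unfocused (S \ w.1)) φ b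
  have hsub : ∀ Γ : Finset (Formula A At), unfocused (knowPart a Γ) ⊆ unfocused Γ := by
    rintro Γ ⟨χ, b⟩ h
    simp only [mem_unfocused, mem_knowPart] at h ⊢
    exact ⟨h.1.1, h.2⟩
  rwa [hΓ, hΔ, Finset.union_eq_left.2 (hsub _), Finset.union_eq_right.2 (hsub _)] at hr

theorem exists_of_know_notMem {a : A} {φ : Formula A At} (h : Formula.know a φ ∈ S)
    (hw : Formula.know a φ ∉ w.1) : ∃ v : World S, w.Rel a v ∧ φ ∉ v.1 := by
  classical
  have := w.right_rule (r := .ruleS5 a) trivial (w.rule_S5 hS a φ .unfoc) h hw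
  simp only [← unfocused_insert, List.mem_singleton, exists_eq_left] at this
  have h₁ : knowPart a w.1 ⊆ S := fun χ hχ => w.2.1 (mem_knowPart.1 hχ).1
  have h₂ : knowPart a (S \ w.1) ⊆ S := fun χ hχ =>
    Finset.sdiff_subset (mem_knowPart.1 hχ).1
  obtain ⟨v, hv, hv'⟩ := exists_world h₁ (Finset.insert_subset (hS.know_mem _ _ h) h₂) this
  exact ⟨v, w.rel_of_knowPart_subset hv fun χ hχ => hv' χ (Finset.mem_insert_of_mem hχ),
    hv' φ (Finset.mem_insert_self _ _)⟩

/-- The canonical model. -/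
def canonicalModel : Model A At (World S) where
  le w v := w.1 ⊆ v.1
  rel a w v := w.Rel a v
  val p w := Formula.atom p ∈ w.1
  le_refl _ := subset_rfl
  le_trans _ _ _ := Finset.Subset.trans
  equivalence _ := ⟨fun _ _ => Iff.rfl, fun h φ => (h φ).symm, fun h h' φ => (h φ).trans (h' φ)⟩
  rel_of_le _ v _ h _ := ⟨fun hv => h hv, v.know_mem_of_subset hS h⟩
  val_mono _ _ _ h hp := h hp

/-- A world that omits `C φ` reaches a world that omits `φ`: otherwise there would be a cyclic
derivation of the sequents `v ⇒ K_a C φ, S ∖ v` with `K_a C φ` in focus. -/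
theorem exists_of_common_notMem {φ : Formula A At} (h : Formula.common φ ∈ S)
    (hw : Formula.common φ ∉ w.1) :
    ∃ v : World S, Relation.ReflTransGen (fun x y : World S => ∃ a, x.Rel a y) w v ∧ φ ∉ v.1 := by
  classical
  by_contra! hno
  obtain ⟨hφ, hK⟩ := hS.common_mem _ h
  have hfoc : ∀ a, (Formula.know a (.common φ)).Focusable := fun a => .inr ⟨a, φ, rfl⟩
  -- The coinductive hypothesis: these focused sequents at all worlds reachable from `w`.
  let Y : Set (SequentOver S) := {τ | ∃ a, ∃ v : World S,
    Relation.ReflTransGen (fun x y : World S => ∃ a, x.Rel a y) w v ∧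
      τ.1.toPreSequent = focusedOn (.know a (.common φ)) v.1 (S \ v.1)}
  have hYmem : ∀ (a : A) (v : World S),
      Relation.ReflTransGen (fun x y : World S => ∃ a, x.Rel a y) w v →
      Holds Y (focusedOn (.know a (.common φ)) v.1 (S \ v.1)) := by
    intro a v hv
    obtain ⟨τ, hτ⟩ := exists_focusedOn (hfoc a) (hK a) v.2.1 (Finset.sdiff_subset : S \ v.1 ⊆ S)
    exact ⟨τ, ⟨a, v, hv, hτ⟩, hτ⟩
  have hleft : ∀ v : World S, Relation.ReflTransGen (fun x y : World S => ∃ a, x.Rel a y) w v →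
      Holds (winSet .cICKS5 S)
        ⟨unfocused v.1, insert (φ, .unfoc) (unfocused (S \ v.1))⟩ := by
    intro v hv
    have := holds_plain_of_mem (P := .cICKS5) trivial v.2.1
      (Finset.insert_subset hφ Finset.sdiff_subset) (hno v hv) (Finset.mem_insert_self φ (S \ v.1))
    rwa [plain, unfocused_insert] at this
  have hY : Y ⊆ winSet .cICKS5 S := by
    refine subset_winSet_of_subset_reachSet .cICKS5 S ?_
    rintro τ ⟨a, v, hv, hτ⟩
    rw [← holds_iff_mem, hτ]
    refine Holds.reachSet_of_rule (r := .ruleS5 a) trivial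
      (v.rule_S5 hS a (.common φ) .foc) (by simp) ⟨τ, hτ⟩ ⟨_, Finset.mem_insert_self _ _⟩ ?_
    rw [List.forall_mem_singleton]
    have h₁ : knowPart a v.1 ⊆ S := fun χ hχ => v.2.1 (mem_knowPart.1 hχ).1
    have h₂ : knowPart a (S \ v.1) ⊆ S := fun χ hχ =>
      Finset.sdiff_subset (mem_knowPart.1 hχ).1
    -- Cuts retain the focus, so they may be applied between `ruleS5` and the next focused
    -- unfolding.
    refine cut_induction (Q := fun Γ Δ => Holds (reachSet .cICKS5 S (Y ∪ winSet .cICKS5 S)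
      (winSet .cICKS5 S)) (focusedOn (.common φ) Γ Δ)) ?_ h₁ h₂ ?_
    · intro Γ Δ ψ hΓ hΔ hψ hl hr
      refine Holds.reachSet_of_rule (r := .cut) trivial (Rule.cut _ _ ψ) (by simp)
        (exists_focusedOn (.inl ⟨φ, rfl⟩) h hΓ hΔ) ⟨_, Finset.mem_insert_self _ _⟩ ?_
      simp only [List.forall_mem_cons, List.not_mem_nil, false_imp_iff, implies_true, and_true]
      rw [focusedOn, unfocused_insert] at hl hr
      rw [Finset.insert_comm] at hr
      exact ⟨hl, hr⟩
    · intro Γ Δ hΓv hΔv hΓ hΔ hΓΔ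
      -- If the unfocused version is winning, the focus is given up. Otherwise the pair is a
      -- reachable world `u`, and unfolding leads to an axiom, as `φ ∈ u`, and to members of `Y`.
      by_cases hplain : Holds (winSet .cICKS5 S) (plain Γ (insert (.common φ) Δ))
      · refine Holds.mono (winSet_subset_reachSet _ _ _) ?_
        refine Holds.winSet_of_rule (r := .unfocus) trivial (Rule.unfocus _ _ (.common φ))
          (exists_focusedOn (.inl ⟨φ, rfl⟩) h hΓ hΔ) ?_
        rw [plain, unfocused_insert] at hplain
        rwa [List.forall_mem_singleton]
      · have hCΓ : Formula.common φ ∉ Γ := fun hC => hplain <|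
          holds_plain_of_mem trivial hΓ (Finset.insert_subset h hΔ) hC (Finset.mem_insert_self _ _)
        have hCΔ : Formula.common φ ∈ Δ :=
          (Finset.mem_union.1 (hΓΔ h)).resolve_left hCΓ
        rw [Finset.insert_eq_of_mem hCΔ] at hplain
        have hΔeq : Δ = S \ Γ := by
          ext χ
          rw [Finset.mem_sdiff]
          refine ⟨fun hχ => ⟨hΔ hχ, fun hχ' => hplain ?_⟩, fun hχ => ?_⟩
          · exact holds_plain_of_mem trivial hΓ hΔ hχ' hχ
          · exact (Finset.mem_union.1 (hΓΔ hχ.1)).resolve_left hχ.2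
        subst hΔeq
        let u : World S := ⟨Γ, hΓ, hplain⟩
        have hu : Relation.ReflTransGen (fun x y : World S => ∃ a, x.Rel a y) w u := by
          refine hv.tail ⟨a, v.rel_of_knowPart_subset hΓv fun χ hχ => ?_⟩
          exact (Finset.mem_sdiff.1 (hΔv hχ)).2
        refine Holds.reachSet_of_commonR trivial
          (exists_focusedOn (.inl ⟨φ, rfl⟩) h hΓ hΔ) ?_
        simp only [commonRPremises, List.forall_mem_cons, List.forall_mem_map, Finset.mem_toList,
          Finset.mem_univ, forall_true_left]
        exact ⟨(hleft u hu).mono Set.subset_union_right,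
          fun b => (hYmem b u hu).mono Set.subset_union_left⟩
  -- Unfolding `C φ` unfocused and then focusing each `K_a C φ` lands in `Y`, so the sequent of `w`
  -- would be winning.
  obtain ⟨σ, hσ, hnot⟩ := w.right_rule (r := .commonR) trivial
    (Rule.commonR _ _ φ .unfoc) h hw
  refine hnot ?_
  clear hnot
  revert σ
  simp only [commonRPremises, List.forall_mem_cons, List.forall_mem_map, Finset.mem_toList,
    Finset.mem_univ, forall_true_left]
  refine ⟨hleft w .refl, fun a => ?_⟩
  have hsub : insert (Formula.know a (.common φ)) (S \ w.1) ⊆ S :=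
    Finset.insert_subset (hK a) Finset.sdiff_subset
  have hseq := exists_plain w.2.1 hsub
  rw [plain, unfocused_insert] at hseq
  refine Holds.winSet_of_rule (r := .focus) trivial (Rule.focus _ _ _) hseq ?_
  rw [List.forall_mem_singleton]
  exact (hYmem a w .refl).mono hY

theorem sat_canonicalModel_iff {φ : Formula A At} (hφ : φ ∈ S) :
    (canonicalModel hS).Sat φ w ↔ φ ∈ w.1 := by
  induction φ generalizing w with
  | bot => exact ⟨False.elim, w.bot_notMem⟩
  | atom p => exact Iff.rfl
  | and φ ψ ih₁ ih₂ =>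
    obtain ⟨h₁, h₂⟩ := hS.and_mem _ _ hφ
    rw [w.and_mem_iff hS hφ, ← ih₁ w h₁, ← ih₂ w h₂]
    rfl
  | or φ ψ ih₁ ih₂ =>
    obtain ⟨h₁, h₂⟩ := hS.or_mem _ _ hφ
    rw [w.or_mem_iff hS hφ, ← ih₁ w h₁, ← ih₂ w h₂]
    rfl
  | imp φ ψ ih₁ ih₂ =>
    obtain ⟨h₁, h₂⟩ := hS.imp_mem _ _ hφ
    constructor
    · intro h
      by_contra hw
      obtain ⟨v, hv, hv₁, hv₂⟩ := w.exists_of_imp_notMem hS hφ hw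
      exact hv₂ ((ih₂ v h₂).1 (h v hv ((ih₁ v h₁).2 hv₁)))
    · exact fun h v hv hs => (ih₂ v h₂).2 (v.mem_of_imp_mem hS (hv h) ((ih₁ v h₁).1 hs))
  | know a φ ih =>
    have h₁ := hS.know_mem _ _ hφ
    constructor
    · intro h
      by_contra hw
      obtain ⟨v, hv, hv'⟩ := w.exists_of_know_notMem hS hφ hw
      exact hv' ((ih v h₁).1 (h v hv))
    · exact fun h v hv => (ih v h₁).2 (v.mem_of_know_mem hS ((hv φ).1 h))
  | common φ ih =>
    obtain ⟨h₁, -⟩ := hS.common_mem _ hφ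
    constructor
    · intro h
      by_contra hw
      obtain ⟨v, hv, hv'⟩ := w.exists_of_common_notMem hS hφ hw
      exact hv' ((ih v h₁).1 (h v hv))
    · intro h v hv
      -- `C φ` travels along the path: it yields `K_a C φ`, which related worlds share, and
      -- reflexivity returns `C φ`.
      have hC : Formula.common φ ∈ v.1 := by
        clear ih
        induction hv with
        | refl => exact h
        | @tail x y _ hxy ih =>
          obtain ⟨a, ha⟩ := hxy
          exact y.mem_of_know_mem hS ((ha _).1 ((x.mem_of_common_mem hS ih).2 a))
      exact (ih v h₁).2 (v.mem_of_common_mem hS hC).1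

end World

/-- Completeness with analytic cuts. -/
theorem mem_winSet_of_provable [Fintype A] [Nonempty A] {S : Finset (Formula A At)}
    (hS : IsNegClosedSet (S : Set (Formula A At))) {σ : SequentOver S}
    (h : Provable .cICKS5 σ.1) : σ ∈ winSet .cICKS5 S := by
  classical
  by_contra hσ
  set Γ := σ.1.left.image Prod.fst with hΓdef
  set Δ := σ.1.right.image Prod.fst with hΔdef
  have hΓ : Γ ⊆ S := by
    intro φ hφ
    obtain ⟨⟨ψ, b⟩, hx, rfl⟩ := Finset.mem_image.1 hφ
    exact σ.2 ψ b (.inl hx)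
  have hΔ : Δ ⊆ S := by
    intro φ hφ
    obtain ⟨⟨ψ, b⟩, hx, rfl⟩ := Finset.mem_image.1 hφ
    exact σ.2 ψ b (.inr hx)
  have hleft : σ.1.left = unfocused Γ := by
    ext ⟨φ, b⟩
    simp only [hΓdef, mem_unfocused, Finset.mem_image, Prod.exists, exists_and_right,
      exists_eq_right]
    have := σ.1.left_unfocused φ
    constructor
    · intro hφ
      cases b
      · exact ⟨⟨_, hφ⟩, rfl⟩
      · exact absurd hφ this
    · rintro ⟨⟨c, hc⟩, rfl⟩
      cases c
      · exact hc
      · exact absurd hc this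
  -- A sequent is winning if its unfocused version is, by the rule `unfocus`.
  have hplain : ¬ Holds (winSet .cICKS5 S) (plain Γ Δ) := by
    intro hp
    apply hσ
    rw [← holds_iff_mem]
    by_cases hf : σ.1.HasFocus
    · obtain ⟨χ, hχ⟩ := hf
      have h₁ : σ.1.toPreSequent =
          ⟨unfocused Γ, insert (χ, .foc) (σ.1.right.erase (χ, .foc))⟩ := by
        rw [Finset.insert_erase hχ, ← hleft]
      have h₂ : unfocused Δ = insert (χ, .unfoc) (σ.1.right.erase (χ, .foc)) := by
        ext ⟨φ, b⟩
        simp only [hΔdef, mem_unfocused, Finset.mem_image, Prod.exists, exists_and_right,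
          exists_eq_right, Finset.mem_insert, Finset.mem_erase, Prod.mk.injEq, ne_eq]
        constructor
        · rintro ⟨⟨c, hc⟩, rfl⟩
          cases c
          · exact .inr ⟨by simp, hc⟩
          · exact .inl ⟨σ.1.focus_unique _ _ hc hχ, rfl⟩
        · rintro (⟨rfl, rfl⟩ | ⟨h₁, h₂⟩)
          · exact ⟨⟨_, hχ⟩, rfl⟩
          · cases b
            · exact ⟨⟨_, h₂⟩, rfl⟩
            · exact absurd ⟨σ.1.focus_unique _ _ h₂ hχ, rfl⟩ h₁
      rw [h₁]
      refine Holds.winSet_of_rule (r := .unfocus) trivial (Rule.unfocus _ _ χ) ⟨σ, h₁⟩ ?_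
      rw [List.forall_mem_singleton, ← h₂]
      exact hp
    · have h₂ : σ.1.right = unfocused Δ := by
        ext ⟨φ, b⟩
        simp only [hΔdef, mem_unfocused, Finset.mem_image, Prod.exists, exists_and_right,
          exists_eq_right]
        constructor
        · intro hφ
          cases b
          · exact ⟨⟨_, hφ⟩, rfl⟩
          · exact absurd ⟨φ, hφ⟩ hf
        · rintro ⟨⟨c, hc⟩, rfl⟩
          cases c
          · exact hc
          · exact absurd ⟨φ, hc⟩ hf
      rwa [show σ.1.toPreSequent = plain Γ Δ from PreSequent.ext hleft h₂]
  obtain ⟨w, hw, hw'⟩ := exists_world hΓ hΔ hplain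
  have hsat : ∀ x ∈ σ.1.left, (World.canonicalModel hS).Sat x.1 w := fun x hx =>
    (w.sat_canonicalModel_iff hS (σ.2 x.1 x.2 (.inl hx))).2
      (hw (Finset.mem_image_of_mem _ hx))
  have hunsat : ∀ x ∈ σ.1.right, ¬ (World.canonicalModel hS).Sat x.1 w := fun x hx hs =>
    hw' x.1 (Finset.mem_image_of_mem _ hx)
      ((w.sat_canonicalModel_iff hS (σ.2 x.1 x.2 (.inr hx))).1 hs)
  by_cases hf : σ.1.HasFocus
  · obtain ⟨χ, hχ⟩ := hf
    obtain ⟨n, hn⟩ := (World.canonicalModel hS).exists_budget (σ.1.focusable χ hχ) (hunsat _ hχ)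
    refine Model.not_refutes_of_provable h n w ⟨hsat, hunsat, ?_⟩
    rintro ⟨ψ, b⟩ hx rfl
    rwa [show ψ = χ from σ.1.focus_unique _ _ hx hχ]
  · refine Model.not_refutes_of_provable h 0 w ⟨hsat, hunsat, ?_⟩
    rintro ⟨ψ, b⟩ hx rfl
    exact absurd ⟨ψ, hx⟩ hf

end ICK

/-! ### The equivalence -/

theorem mainTheorem10 {A At : Type*} [Fintype A] [Nonempty A] (P : ICK.Calculus)
    (S : Finset (ICK.Formula A At)) (hS : P.IsClosed (S : Set (ICK.Formula A At)))
    (σ : ICK.Sequent A At) (hσ : σ.IsOver S) :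
    List.TFAE [
      ICK.Provable P σ,
      ICK.HasProofOver P S σ,
      (ICK.proofSearchGame P S ⟨σ, hσ⟩).HasMemorylessWinningStrategy .prover,
      ICK.HasUniformProofOver P S σ] := by
  have h43 : (ICK.proofSearchGame P S ⟨σ, hσ⟩).HasMemorylessWinningStrategy .prover →
      ICK.HasUniformProofOver P S σ := ICK.hasUniformProofOver_of_strategy
  have h42 : ICK.HasUniformProofOver P S σ → ICK.HasProofOver P S σ :=
    fun ⟨π, hπ, hS, _⟩ => ⟨π, hπ, hS⟩
  tfae_have 3 → 4 := h43
  tfae_have 4 → 2 := h42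
  tfae_have 2 → 1 := fun ⟨π, hπ, _⟩ => ⟨π, hπ⟩
  tfae_have 2 → 3 := by
    rintro ⟨π, hπ, hπS⟩
    refine ICK.hasMemorylessWinningStrategy_of_mem_winSet ?_
    have hlab := hπ.root
    subst hlab
    exact ICK.mem_winSet_of_correct P S (hπ.correct_over hπS) hσ
  tfae_have 1 → 2 := by
    intro h
    -- With cut, the given proof may leave `S`, so a new one is obtained from completeness; without
    -- cut the proof itself is an `S`-proof.
    by_cases hP : P = .cICKS5
    · subst hP
      exact h42 (h43 (ICK.hasMemorylessWinningStrategy_of_mem_winSet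
        (ICK.mem_winSet_of_provable hS h)))
    · obtain ⟨π, hπ⟩ := h
      exact ⟨π, hπ, hπ.isOver hP hS.isClosedSet hσ⟩
  tfae_finish
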